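/- For a graph $G$ and $g\in\{3,4,\dots\}\cup\{\infty\}$, let the $g$-girth-thickness $\theta(g,G)$ be the minimum number of planar subgraphs of $G$ of girth at least $g$ whose union is $G$. Here a graph is planar if it can be embedded in the plane without any two of its edges crossing, and an acyclic graph has girth $\infty$. Theorem. Let $K_n$ be the complete graph on $n$ vertices. Then $\theta(4,K_n)=\left\lceil \frac{n+2}{4}\right\rceil$ for every integer $n\ge 1$ with $n\ne 6,10$, and $\theta(4,K_6)=3$. -/

import Mathlib

/-- A drawing of the graph `G` in the plane `ℝ × ℝ` without crossings: vertices are distinct points,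
every edge is a simple arc (a continuous injective image of the unit interval) joining the points
of its two ends, no arc runs through a vertex in its interior, and the interiors of the arcs of two
different edges are disjoint. -/
structure PlaneEmbedding {V : Type*} (G : SimpleGraph V) where
  /-- the point that represents a vertex -/
  point : V → ℝ × ℝ
  /-- the parametrized arc that represents an edge; only its values on `[0, 1]` matter -/
  arc : G.edgeSet → ℝ → ℝ × ℝ
  point_injective : Function.Injective point
  arc_continuousOn : ∀ e, ContinuousOn (arc e) (Set.Icc 0 1)
  arc_injOn : ∀ e, Set.InjOn (arc e) (Set.Icc 0 1)
  arc_ends : ∀ e, s(arc e 0, arc e 1) = Sym2.map point (e : Sym2 V)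
  arc_ne_point : ∀ e, ∀ t ∈ Set.Ioo (0 : ℝ) 1, ∀ v, arc e t ≠ point v
  arc_disjoint : ∀ e f, e ≠ f → Disjoint (arc e '' Set.Ioo 0 1) (arc f '' Set.Ioo 0 1)

/-- A graph is planar if it can be embedded in the plane without crossing edges. -/
def IsPlanarGraph {V : Type*} (G : SimpleGraph V) : Prop :=
  Nonempty (PlaneEmbedding G)

/-- `G` is the union of `k` of its subgraphs (both vertices and edges are covered), each of which
is planar and has girth at least `g`; an acyclic graph has girth `∞`. -/
def IsUnionOfPlanarGirth {V : Type*} (g : ℕ∞) (G : SimpleGraph V) (k : ℕ) : Prop :=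
  ∃ H : Fin k → G.Subgraph,
    (∀ i, IsPlanarGraph (H i).coe ∧ g ≤ (H i).coe.egirth) ∧ ⨆ i, H i = ⊤

/-- The `g`-girth-thickness of `G`: the minimum number of planar subgraphs of girth at least `g`
whose union is `G` (`⊤` if no finite number suffices). -/
noncomputable def girthThickness {V : Type*} (g : ℕ∞) (G : SimpleGraph V) : ℕ∞ :=
  ⨅ (k : ℕ) (_ : IsUnionOfPlanarGirth g G k), (k : ℕ∞)

/-! Lower bound. A planar triangle-free graph on v ≥ 3 vertices has at most 2v - 4 edges, and
counting the edges of K_n then forces n + 2 ≤ 4k for k subgraphs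
(`IsUnionOfPlanarGirth.add_two_le`). Since the drawings are topological, faces are replaced by an
abstract dual over `ZMod 2`. Thickened vertices and truncated arcs, suitably rescaled, exhibit the
graph as a minor of the square grid. Cycles of the grid are cuts of its dual, and this property
passes to minors (`SimpleGraph.hasDual_of_minor`). The cycle space is therefore spanned by vectors
that together use each edge at most twice, and double counting takes the place of Euler's formula.
For K_6 the count allows two subgraphs, but the Ramsey number R(3,3) = 6 excludes them.

Upper bound. For k ≥ 3 the graph K_{4k+2} is covered by k + 1 bipartite planar graphs. Its vertices
are two copies of every residue modulo 2k, and two poles. K_{2k} decomposes into k zigzag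
Hamiltonian paths; doubling the vertices of a path gives nested quadrilaterals, and these graphs
cover all edges between copies of different residues. In each of them either pole fits into a
quadrilateral face and is joined to two opposite corners. The edges left over form disjoint paths of
length three between the poles, together with the edge joining the poles
(`isUnionOfPlanarGirth_zigzag`). The placement of the poles breaks down for k = 2, the case needed
for n = 10; for n ≤ 9 explicit decompositions are checked by computation. -/

open Finset Filter Topology

/-! ### Cycle spaces, abstract duals and the edge bound -/

namespace SimpleGraph

/-- The boundary over `ZMod 2` of a set of edges: the parity of the degree at every vertex. -/
noncomputable def edgeBoundary {V : Type*} [Fintype V] [DecidableEq V] (G : SimpleGraph V)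
    [Fintype G.edgeSet] : (G.edgeSet → ZMod 2) →ₗ[ZMod 2] (V → ZMod 2) where
  toFun x v := ∑ e : G.edgeSet, if v ∈ (e : Sym2 V) then x e else 0
  map_add' x y := by
    ext v
    simp only [Pi.add_apply, ← Finset.sum_add_distrib]
    exact Finset.sum_congr rfl fun e _ => by split_ifs <;> simp
  map_smul' c x := by
    ext v
    simp only [Pi.smul_apply, smul_eq_mul, RingHom.id_apply, Finset.mul_sum]
    exact Finset.sum_congr rfl fun e _ => by split_ifs <;> simp

section

variable {V : Type*} [Fintype V] [DecidableEq V] (G : SimpleGraph V) [Fintype G.edgeSet]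

theorem edgeBoundary_apply (x : G.edgeSet → ZMod 2) (v : V) :
    G.edgeBoundary x v = ∑ e : G.edgeSet, if v ∈ (e : Sym2 V) then x e else 0 := rfl

theorem sum_edgeBoundary (x : G.edgeSet → ZMod 2) : ∑ v, G.edgeBoundary x v = 0 := by
  simp only [edgeBoundary_apply]
  rw [Finset.sum_comm]
  refine Finset.sum_eq_zero fun e _ => ?_
  obtain ⟨e, he⟩ := e
  induction e using Sym2.ind with
  | _ a b =>
    have hab : a ≠ b := G.ne_of_adj he
    rw [← Finset.sum_filter, Finset.sum_const]
    have : ({v | v ∈ s(a, b)} : Finset V) = {a, b} := by ext; simp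
    rw [this, Finset.card_pair hab, two_nsmul, CharTwo.add_self_eq_zero]

/-- Boundaries lie in the hyperplane of vectors with sum zero, so the rank of the boundary map is at
most |V| - 1. -/
theorem card_edgeSet_lt_finrank_ker_edgeBoundary [Nonempty V] :
    Fintype.card G.edgeSet + 1 ≤
      Module.finrank (ZMod 2) (LinearMap.ker G.edgeBoundary) + Fintype.card V := by
  have h1 := LinearMap.finrank_range_add_finrank_ker G.edgeBoundary
  rw [Module.finrank_fintype_fun_eq_card] at h1
  let s : (V → ZMod 2) →ₗ[ZMod 2] ZMod 2 := ∑ v, LinearMap.proj v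
  have hs : ∀ f, s f = ∑ v, f v := fun f => by simp [s]
  have h2 : LinearMap.range G.edgeBoundary ≤ LinearMap.ker s := by
    rintro _ ⟨x, rfl⟩
    rw [LinearMap.mem_ker, hs, sum_edgeBoundary]
  have h3 := LinearMap.finrank_range_add_finrank_ker s
  rw [Module.finrank_fintype_fun_eq_card] at h3
  have h4 : LinearMap.range s = ⊤ := by
    rw [LinearMap.range_eq_top]
    intro c
    obtain ⟨v⟩ := ‹Nonempty V›
    exact ⟨Pi.single v c, by simp [hs]⟩
  rw [h4, finrank_top, Module.finrank_self] at h3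
  have h5 := Submodule.finrank_mono h2
  omega

theorem exists_other_edge_of_mem_ker {x : G.edgeSet → ZMod 2} (hx : G.edgeBoundary x = 0)
    {u v : V} (h : G.Adj u v) (hxe : x ⟨s(u, v), h⟩ ≠ 0) :
    ∃ w, ∃ hw : G.Adj u w, w ≠ v ∧ x ⟨s(u, w), hw⟩ ≠ 0 := by
  by_contra! hc
  have := congrFun hx u
  rw [edgeBoundary_apply, Finset.sum_eq_single ⟨s(u, v), h⟩] at this
  · simp at this
    exact hxe this
  · rintro ⟨e, he⟩ - hne
    split_ifs with hu
    · obtain ⟨w, rfl⟩ := Sym2.mem_iff_exists.1 hu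
      exact hc w he fun hwv => hne (by subst hwv; rfl)
    · rfl
  · simp

/-- Even degrees allow an edge uv of the support to be continued to uw and vy, and then beyond w to
wz. Without triangles w ≠ y, which makes these four edges distinct. -/
theorem four_le_card_support_of_mem_ker (hG : G.CliqueFree 3) {x : G.edgeSet → ZMod 2}
    (hx : G.edgeBoundary x = 0) (hx0 : x ≠ 0) : 4 ≤ #{e | x e ≠ 0} := by
  obtain ⟨⟨e, he⟩, hxe⟩ := Function.ne_iff.1 hx0
  induction e using Sym2.ind with
  | _ u v =>
    have huv : G.Adj u v := he
    obtain ⟨w, huw, hwv, hxw⟩ := G.exists_other_edge_of_mem_ker hx huv hxe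
    have hxe' : x ⟨s(v, u), huv.symm⟩ ≠ 0 := by
      rwa [show (⟨s(v, u), huv.symm⟩ : G.edgeSet) = ⟨s(u, v), he⟩ from Subtype.ext Sym2.eq_swap]
    obtain ⟨y, hvy, hyu, hxy⟩ := G.exists_other_edge_of_mem_ker hx huv.symm hxe'
    have hxw' : x ⟨s(w, u), huw.symm⟩ ≠ 0 := by
      rwa [show (⟨s(w, u), huw.symm⟩ : G.edgeSet) = ⟨s(u, w), huw⟩ from Subtype.ext Sym2.eq_swap]
    obtain ⟨z, hwz, hzu, hxz⟩ := G.exists_other_edge_of_mem_ker hx huw.symm hxw'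
    have hwy : w ≠ y := by
      rintro rfl
      exact hG {u, v, w} (by rw [is3Clique_triple_iff]; exact ⟨huv, huw, hvy⟩)
    have huv' := huv.ne
    have huw' := huw.ne
    have hvy' := hvy.ne
    have hwz' := hwz.ne
    let S : Finset G.edgeSet := {⟨s(u, v), huv⟩, ⟨s(u, w), huw⟩, ⟨s(v, y), hvy⟩, ⟨s(w, z), hwz⟩}
    have hS : #S = 4 := by
      simp only [S]
      rw [card_insert_of_notMem, card_insert_of_notMem, card_insert_of_notMem, card_singleton] <;>
        simp only [mem_insert, mem_singleton, not_or] <;> grind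
    rw [← hS]
    refine card_le_card fun e he => ?_
    simp only [S, mem_insert, mem_singleton] at he
    rw [mem_filter]
    refine ⟨mem_univ _, ?_⟩
    rcases he with rfl | rfl | rfl | rfl <;> assumption

end

/-- `G` has an abstract dual over `ZMod 2`: its edges can be viewed as edges of a second multigraph
(on `F`, with ends `l` and `r`) whose cuts are exactly the cycles of `G`. -/
def HasDual {V : Type*} [Fintype V] [DecidableEq V] (G : SimpleGraph V) [Fintype G.edgeSet] :
    Prop :=
  ∃ (F : Type) (l r : G.edgeSet → F), ∀ x : G.edgeSet → ZMod 2,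
    G.edgeBoundary x = 0 ↔ ∃ φ : F → ZMod 2, ∀ e, x e = φ (l e) + φ (r e)

/-- The stars `B f` of the dual vertices play the role of face boundaries. A basis of the cycle
space chosen among them, together with its sum, gives dim + 1 cycles with at least four edges each
that use every edge at most twice. Hence 4 (dim + 1) ≤ 2|E|, while dim ≥ |E| - |V| + 1. -/
theorem card_edgeSet_add_four_le_of_hasDual {V : Type*} [Fintype V] [DecidableEq V]
    (G : SimpleGraph V) [Fintype G.edgeSet] (hG : G.CliqueFree 3) (hV : 3 ≤ Fintype.card V)
    (hd : G.HasDual) : Fintype.card G.edgeSet + 4 ≤ 2 * Fintype.card V := by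
  classical
  obtain ⟨F, l, r, hd⟩ := hd
  have : Nonempty V := Fintype.card_pos_iff.1 (by omega)
  have hm := G.card_edgeSet_lt_finrank_ker_edgeBoundary
  let S : Finset F := univ.image l ∪ univ.image r
  have hl : ∀ e, l e ∈ S := fun e => by simp [S]
  have hr : ∀ e, r e ∈ S := fun e => by simp [S]
  let B : S → G.edgeSet → ZMod 2 := fun f e =>
    (if l e = f then 1 else 0) + (if r e = f then 1 else 0)
  have hB : ∀ f, G.edgeBoundary (B f) = 0 := fun f =>
    (hd _).2 ⟨fun g => if g = f then 1 else 0, fun e => rfl⟩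
  have hspan : Submodule.span (ZMod 2) (Set.range B) = LinearMap.ker G.edgeBoundary := by
    apply le_antisymm
    · rw [Submodule.span_le]
      rintro _ ⟨f, rfl⟩
      exact hB f
    · intro x hx
      obtain ⟨φ, hφ⟩ := (hd x).1 hx
      have : x = ∑ f : S, φ f • B f := by
        ext e
        rw [hφ, Finset.sum_apply]
        simp only [B, Pi.smul_apply, smul_eq_mul, mul_add, mul_ite, mul_one, mul_zero,
          Finset.sum_add_distrib]
        congr 1
        · rw [Finset.sum_eq_single ⟨l e, hl e⟩]
          · simp
          · rintro ⟨b, hb⟩ - hne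
            rw [if_neg]
            rintro rfl
            exact hne rfl
          · simp
        · rw [Finset.sum_eq_single ⟨r e, hr e⟩]
          · simp
          · rintro ⟨b, hb⟩ - hne
            rw [if_neg]
            rintro rfl
            exact hne rfl
          · simp
      rw [this]
      exact Submodule.sum_mem _ fun f _ => Submodule.smul_mem _ _ (Submodule.subset_span ⟨f, rfl⟩)
  obtain ⟨κ, a, ha, hκ, hli⟩ := exists_linearIndependent' (ZMod 2) B
  have : Finite κ := Finite.of_injective a ha
  have := Fintype.ofFinite κ
  have hrank : Module.finrank (ZMod 2) (LinearMap.ker G.edgeBoundary) = Fintype.card κ := by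
    rw [← hspan, ← hκ, finrank_span_eq_card hli]
  by_cases hk : Fintype.card κ = 0
  · omega
  -- The sum of the basis stands for the remaining face; it is nonzero by independence.
  let B0 : G.edgeSet → ZMod 2 := ∑ i, B (a i)
  have hB0 : B0 ≠ 0 := by
    intro h0
    obtain ⟨i⟩ : Nonempty κ := Fintype.card_pos_iff.1 (by omega)
    have := Fintype.linearIndependent_iff.1 hli (fun _ => 1) (by simpa [B0] using h0) i
    exact one_ne_zero this
  have hker0 : G.edgeBoundary B0 = 0 := by
    simp only [B0, map_sum, hB, Finset.sum_const_zero]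
  have h4 := G.four_le_card_support_of_mem_ker hG hker0 hB0
  have h4' : ∀ i, 4 ≤ #{e | B (a i) e ≠ 0} := fun i =>
    G.four_le_card_support_of_mem_ker hG (hB _) (hli.ne_zero i)
  -- Only the stars of `l e` and `r e` can contain `e`, and `B0` contains it only if an odd number
  -- of the chosen ones do, that is, exactly one.
  have hcount : ∀ e, #{i | B (a i) e ≠ 0} + (if B0 e ≠ 0 then 1 else 0) ≤ 2 := by
    intro e
    have hle : #{i | B (a i) e ≠ 0} ≤ 2 := by
      refine le_trans (Finset.card_le_card_of_injOn a (t := {⟨l e, hl e⟩, ⟨r e, hr e⟩}) ?_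
        ha.injOn) Finset.card_le_two
      intro i hi
      simp only [B, coe_filter, mem_univ, true_and, Set.mem_ofPred_eq] at hi
      by_contra hc
      simp only [coe_insert, coe_singleton, Set.mem_insert_iff, Set.mem_singleton_iff, not_or,
        Subtype.ext_iff] at hc
      rw [if_neg (Ne.symm hc.1), if_neg (Ne.symm hc.2)] at hi
      simp at hi
    split_ifs with h0
    · have : B0 e = (#{i | B (a i) e ≠ 0} : ZMod 2) := by
        simp only [B0, Finset.sum_apply]
        rw [Finset.card_filter, Nat.cast_sum]
        refine Finset.sum_congr rfl fun i _ => ?_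
        generalize B (a i) e = t
        revert t
        decide
      rw [this] at h0
      rcases hle.lt_or_eq with h | h
      · omega
      · rw [h] at h0
        exact absurd (by decide) h0
    · omega
  have hsum : ∑ i, #{e | B (a i) e ≠ 0} + #{e | B0 e ≠ 0} ≤ 2 * Fintype.card G.edgeSet := by
    have : ∑ i, #{e | B (a i) e ≠ 0} + #{e | B0 e ≠ 0} =
        ∑ e, (#{i | B (a i) e ≠ 0} + (if B0 e ≠ 0 then 1 else 0)) := by
      rw [Finset.sum_add_distrib, ← Finset.card_filter]
      congr 1
      simp only [Finset.card_filter]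
      exact Finset.sum_comm
    rw [this]
    refine (Finset.sum_le_sum fun e _ => hcount e).trans ?_
    simp [mul_comm]
  have h5 : Fintype.card κ * 4 ≤ ∑ i, #{e | B (a i) e ≠ 0} := by
    rw [← Finset.card_univ, ← smul_eq_mul]
    exact Finset.card_nsmul_le_sum _ _ _ fun i _ => h4' i
  omega

end SimpleGraph

/-! ### Abstract duals of minors -/

/-- The boundary over `ZMod 2` of a finite edge chain of the multigraph with ends `s` and `t`. -/
noncomputable def chainBoundary {P E : Type*} (s t : E → P) :
    (E →₀ ZMod 2) →ₗ[ZMod 2] (P →₀ ZMod 2) :=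
  Finsupp.linearCombination (ZMod 2) fun e => Finsupp.single (s e) 1 + Finsupp.single (t e) 1

theorem chainBoundary_single {P E : Type*} (s t : E → P) (e : E) (c : ZMod 2) :
    chainBoundary s t (Finsupp.single e c) = Finsupp.single (s e) c + Finsupp.single (t e) c := by
  simp [chainBoundary, Finsupp.linearCombination_single]

/-- `p` and `q` are the ends of an edge, both in `A`. -/
def StepIn {P E : Type*} (s t : E → P) (A : Set P) (p q : P) : Prop :=
  p ∈ A ∧ q ∈ A ∧ ∃ e, (s e = p ∧ t e = q) ∨ (s e = q ∧ t e = p)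

/-- Any two points of `A` are joined by a walk in `A`. -/
def WalkConnected {P E : Type*} (s t : E → P) (A : Set P) : Prop :=
  ∀ p ∈ A, ∀ q ∈ A, Relation.ReflTransGen (StepIn s t A) p q

theorem exists_chain_of_walk {P E : Type*} (s t : E → P) (A : Set P) {p q : P}
    (h : Relation.ReflTransGen (StepIn s t A) p q) :
    ∃ c : E →₀ ZMod 2, (∀ e, c e ≠ 0 → s e ∈ A ∧ t e ∈ A) ∧
      chainBoundary s t c = Finsupp.single p 1 + Finsupp.single q 1 := by
  classical
  induction h with
  | refl =>
    refine ⟨0, by simp, ?_⟩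
    rw [map_zero, ← Finsupp.single_add, CharTwo.add_self_eq_zero, Finsupp.single_zero]
  | @tail b d _ hs ih =>
    obtain ⟨c, hc, hb⟩ := ih
    obtain ⟨hbA, hdA, e, he⟩ := hs
    refine ⟨c + Finsupp.single e 1, fun e' he' => ?_, ?_⟩
    · by_cases h : e' = e
      · subst h
        rcases he with ⟨rfl, rfl⟩ | ⟨rfl, rfl⟩ <;> exact ⟨by assumption, by assumption⟩
      · refine hc e' fun h0 => he' ?_
        rw [Finsupp.add_apply, h0, Finsupp.single_eq_of_ne h, add_zero]
    · rw [map_add, hb, chainBoundary_single]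
      have key : Finsupp.single (s e) (1 : ZMod 2) + Finsupp.single (t e) 1 =
          Finsupp.single b 1 + Finsupp.single d 1 := by
        rcases he with ⟨rfl, rfl⟩ | ⟨rfl, rfl⟩
        · rfl
        · exact add_comm _ _
      have h2 : Finsupp.single b (1 : ZMod 2) + Finsupp.single b 1 = 0 := by
        rw [← Finsupp.single_add, CharTwo.add_self_eq_zero, Finsupp.single_zero]
      rw [key, add_assoc, ← add_assoc (Finsupp.single b 1), h2, zero_add]

namespace SimpleGraph

/-- Cycles of `G` lift to cycles of the large graph because they can be closed up inside the
connected branch sets. Conversely a cycle supported on `H` restricts to a cycle of `G`, as is seen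
by adding its boundary over each branch set. The finiteness assumption makes the relevant cuts
finite chains. -/
theorem hasDual_of_minor {P E F : Type} (s t : E → P) (l r : E → F)
    (hdual : ∀ z : E →₀ ZMod 2,
      chainBoundary s t z = 0 ↔ ∃ φ : F → ZMod 2, ∀ e, z e = φ (l e) + φ (r e))
    {V : Type*} [Fintype V] [DecidableEq V] (G : SimpleGraph V) [Fintype G.edgeSet]
    (U : V → Set P) (hfin : ∀ v, {e | s e ∈ U v ∧ t e ∈ U v}.Finite)
    (hne : ∀ v, (U v).Nonempty)
    (hdisj : ∀ u v p, p ∈ U u → p ∈ U v → u = v) (hconn : ∀ v, WalkConnected s t (U v))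
    (hadj : ∀ e : G.edgeSet, ∃ d u v, (e : Sym2 V) = s(u, v) ∧ s d ∈ U u ∧ t d ∈ U v) :
    G.HasDual := by
  classical
  choose ε a b hab hsε htε using hadj
  have hne' : ∀ e, a e ≠ b e := fun e h => by
    have := e.2
    rw [hab, h] at this
    exact G.loopless.irrefl _ this
  have hε : Function.Injective ε := fun e f h => by
    have h1 := hdisj _ _ _ (hsε e) (h ▸ hsε f)
    have h2 := hdisj _ _ _ (htε e) (h ▸ htε f)
    exact Subtype.ext (by rw [hab, hab, h1, h2])
  have hmem : ∀ (v : V) (e : G.edgeSet), v ∈ (e : Sym2 V) ↔ v = a e ∨ v = b e := fun v e => by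
    rw [hab, Sym2.mem_iff]
  let inside : Set E := {e | ∃ v, s e ∈ U v ∧ t e ∈ U v}
  have hinside : inside.Finite := by
    have : inside = ⋃ v, {e | s e ∈ U v ∧ t e ∈ U v} := by ext; simp [inside]
    rw [this]
    exact Set.finite_iUnion hfin
  have hεinside : ∀ e, ε e ∉ inside := fun e ⟨v, h1, h2⟩ =>
    hne' e ((hdisj _ _ _ (hsε e) h1).trans (hdisj _ _ _ h2 (htε e)))
  let H : Set E := inside ∪ Set.range ε
  have hH : H.Finite := hinside.union (Set.finite_range ε)
  -- the number of points in `U v`, mod 2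
  let cnt : V → (P →₀ ZMod 2) →ₗ[ZMod 2] ZMod 2 := fun v =>
    Finsupp.linearCombination (ZMod 2) fun p => if p ∈ U v then 1 else 0
  -- An edge inside a branch set contributes both its ends and cancels; only the edges representing
  -- those of `G` remain.
  have hcnt : ∀ z : E →₀ ZMod 2, (∀ e, z e ≠ 0 → e ∈ H) → ∀ v,
      cnt v (chainBoundary s t z) = G.edgeBoundary (fun e => z (ε e)) v := by
    intro z hz v
    have h1 : cnt v (chainBoundary s t z) = ∑ e ∈ z.support,
        z e * ((if s e ∈ U v then 1 else 0) + (if t e ∈ U v then 1 else 0)) := by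
      rw [chainBoundary, Finsupp.linearCombination_apply (l := z), Finsupp.sum, map_sum]
      refine Finset.sum_congr rfl fun e _ => ?_
      rw [map_smul, map_add]
      simp [cnt, Finsupp.linearCombination_single]
    rw [h1, edgeBoundary_apply]
    have h2 : ∀ e, e ∉ Set.range ε → e ∈ z.support →
        z e * ((if s e ∈ U v then 1 else 0) + (if t e ∈ U v then (1 : ZMod 2) else 0)) = 0 := by
      intro e he hes
      have heH : e ∈ H := hz e (by simpa using hes)
      obtain ⟨w, hw1, hw2⟩ := heH.resolve_right he
      by_cases hwv : w = v
      · subst hwv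
        rw [if_pos hw1, if_pos hw2, CharTwo.add_self_eq_zero, mul_zero]
      · rw [if_neg fun h => hwv (hdisj _ _ _ hw1 h), if_neg fun h => hwv (hdisj _ _ _ hw2 h)]
        simp
    have h3 : ∀ e, z (ε e) * ((if s (ε e) ∈ U v then 1 else 0) +
        (if t (ε e) ∈ U v then (1 : ZMod 2) else 0)) =
          if v ∈ (e : Sym2 V) then z (ε e) else 0 := by
      intro e
      have h4 : s (ε e) ∈ U v ↔ v = a e :=
        ⟨fun h => hdisj _ _ _ h (hsε e), fun h => h ▸ hsε e⟩
      have h5 : t (ε e) ∈ U v ↔ v = b e :=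
        ⟨fun h => hdisj _ _ _ h (htε e), fun h => h ▸ htε e⟩
      simp only [h4, h5, hmem]
      have := hne' e
      by_cases h6 : v = a e
      · have h7 : v ≠ b e := h6 ▸ this
        simp [h6, this]
      · by_cases h7 : v = b e <;> simp [h6, h7, this.symm]
    simp only [← h3]
    rw [← Finset.sum_image (s := univ) (g := ε)
      (f := fun d => z d * ((if s d ∈ U v then 1 else 0) + if t d ∈ U v then (1 : ZMod 2) else 0))
      hε.injOn]
    symm
    rw [← Finset.sum_subset (Finset.inter_subset_right (s₁ := z.support)), Finset.sum_subset
      (Finset.inter_subset_left (s₂ := univ.image ε))]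
    · intro e he hne
      refine h2 e ?_ he
      rintro ⟨e', rfl⟩
      exact hne (by simp [Finsupp.mem_support_iff.1 he])
    · intro e he hne
      have : z e = 0 := by
        by_contra h
        exact hne (mem_inter.2 ⟨Finsupp.mem_support_iff.2 h, he⟩)
      rw [this, zero_mul]
  -- Deleting an edge contracts its dual edge: the two faces along every edge outside `H` are
  -- merged.
  let rel : F → F → Prop := fun f g => ∃ e, e ∉ H ∧ l e = f ∧ r e = g
  refine ⟨Quot rel, fun e => Quot.mk _ (l (ε e)), fun e => Quot.mk _ (r (ε e)), fun x => ?_⟩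
  constructor
  · intro hx
    choose o ho using hne
    have hroot : ∀ v, ∀ p ∈ U v, ∃ c : E →₀ ZMod 2, (∀ e, c e ≠ 0 → e ∈ inside) ∧
        chainBoundary s t c = Finsupp.single p 1 + Finsupp.single (o v) 1 := fun v p hp => by
      obtain ⟨c, hc, h⟩ := exists_chain_of_walk s t (U v) (hconn v p hp (o v) (ho v))
      exact ⟨c, fun e he => ⟨v, hc e he⟩, h⟩
    choose ca hca hba using fun e => hroot (a e) _ (hsε e)
    choose cb hcb hbb using fun e => hroot (b e) _ (htε e)
    -- Every edge is prolonged within the branch sets of its ends to their base points `o`, so the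
    -- boundary of the lift is that of `x`, placed at the base points.
    let z : E →₀ ZMod 2 := ∑ e, x e • (Finsupp.single (ε e) 1 + (ca e + cb e))
    have hzero : ∀ d, d ∉ inside → ∀ e, (ca e + cb e) d = 0 := by
      intro d hd e
      rw [Finsupp.add_apply, not_ne_iff.1 (mt (hca e d) hd),
        not_ne_iff.1 (mt (hcb e d) hd), add_zero]
    have hzε : ∀ e, z (ε e) = x e := by
      intro e
      simp only [z, Finsupp.finsetSum_apply]
      rw [Finset.sum_eq_single e]
      · rw [Finsupp.smul_apply, Finsupp.add_apply, hzero _ (hεinside e)]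
        simp
      · intro e' _ hne
        rw [Finsupp.smul_apply, Finsupp.add_apply, hzero _ (hεinside e),
          Finsupp.single_eq_of_ne (fun h => hne (hε h).symm)]
        simp
      · simp
    have hzH : ∀ d, d ∉ H → z d = 0 := by
      intro d hd
      simp only [z, Finsupp.finsetSum_apply]
      refine Finset.sum_eq_zero fun e _ => ?_
      rw [Finsupp.smul_apply, Finsupp.add_apply, hzero _ (fun h => hd (Or.inl h)),
        Finsupp.single_eq_of_ne (fun h => hd (Or.inr ⟨e, h.symm⟩))]
      simp
    have hz0 : chainBoundary s t z = 0 := by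
      have h1 : ∀ e, chainBoundary s t (Finsupp.single (ε e) 1 + (ca e + cb e)) =
          Finsupp.single (o (a e)) 1 + Finsupp.single (o (b e)) 1 := by
        intro e
        rw [map_add, map_add, hba, hbb, chainBoundary_single]
        ext p
        simp only [Finsupp.add_apply]
        generalize Finsupp.single (s (ε e)) (1 : ZMod 2) p = i
        generalize Finsupp.single (t (ε e)) (1 : ZMod 2) p = j
        generalize Finsupp.single (o (a e)) (1 : ZMod 2) p = k
        generalize Finsupp.single (o (b e)) (1 : ZMod 2) p = m
        revert i j k m
        decide
      have h2 : chainBoundary s t z = ∑ v, Finsupp.single (o v) (G.edgeBoundary x v) := by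
        simp only [z, map_sum, map_smul, h1, edgeBoundary_apply]
        simp only [Finsupp.single_finsetSum]
        rw [Finset.sum_comm]
        refine Finset.sum_congr rfl fun e _ => ?_
        have h3 : ∀ v, Finsupp.single (o v) (if v ∈ (e : Sym2 V) then x e else 0) =
            (if v = a e then Finsupp.single (o v) (x e) else 0) +
              (if v = b e then Finsupp.single (o v) (x e) else 0) := by
          intro v
          have := hne' e
          by_cases h6 : v = a e
          · have h7 : v ≠ b e := h6 ▸ this
            simp [hmem, h6, this]
          · by_cases h7 : v = b e <;> simp [hmem, h6, h7, this.symm]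
        simp only [h3, Finset.sum_add_distrib, Finset.sum_ite_eq', mem_univ, if_true, smul_add,
          Finsupp.smul_single, smul_eq_mul, mul_one]
      rw [h2]
      refine Finset.sum_eq_zero fun v _ => ?_
      rw [hx]
      simp
    obtain ⟨φ, hφ⟩ := (hdual z).1 hz0
    refine ⟨Quot.lift φ ?_, fun e => ?_⟩
    · rintro _ _ ⟨d, hd, rfl, rfl⟩
      have := hφ d
      rw [hzH d hd] at this
      exact (CharTwo.add_eq_zero.1 this.symm)
    · rw [← hzε, hφ]
  · rintro ⟨ψ, hψ⟩
    let φ : F → ZMod 2 := fun f => ψ (Quot.mk _ f)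
    have hoff : ∀ d, d ∉ H → φ (l d) + φ (r d) = 0 := by
      intro d hd
      rw [CharTwo.add_eq_zero]
      exact congrArg ψ (Quot.sound ⟨d, hd, rfl, rfl⟩)
    let z : E →₀ ZMod 2 := Finsupp.onFinset hH.toFinset (fun d => φ (l d) + φ (r d))
      fun d hd => by
        rw [Set.Finite.mem_toFinset]
        by_contra h
        exact hd (hoff d h)
    have hz0 : chainBoundary s t z = 0 := (hdual z).2 ⟨φ, fun e => rfl⟩
    ext v
    have := hcnt z (fun e he => by
      by_contra h
      exact he (hoff e h)) v
    rw [hz0, map_zero] at this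
    rw [Pi.zero_apply, this]
    exact congrFun (congrArg _ (funext hψ)) v

end SimpleGraph

/-! ### The grid and its dual -/

/-- The first end of an edge of the grid on `ℕ × ℕ`; an edge is given by this end and by its
direction, `true` for horizontal. -/
def gridSrc (e : (ℕ × ℕ) × Bool) : ℕ × ℕ := e.1

/-- The second end of an edge of the grid. -/
def gridTgt (e : (ℕ × ℕ) × Bool) : ℕ × ℕ :=
  if e.2 then (e.1.1 + 1, e.1.2) else (e.1.1, e.1.2 + 1)

/-- The face on one side of a grid edge, where `(i + 1, j + 1)` stands for the unit square with
lower left corner `(i, j)` and `(0, 0)` for the unbounded face. -/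
def gridLeft (e : (ℕ × ℕ) × Bool) : ℕ × ℕ :=
  if e.2 then (if e.1.2 = 0 then (0, 0) else (e.1.1 + 1, e.1.2))
  else (if e.1.1 = 0 then (0, 0) else (e.1.1, e.1.2 + 1))

/-- The face on the other side of a grid edge. -/
def gridRight (e : (ℕ × ℕ) × Bool) : ℕ × ℕ := (e.1.1 + 1, e.1.2 + 1)

theorem chainBoundary_grid_apply (z : (ℕ × ℕ) × Bool →₀ ZMod 2) (i j : ℕ) :
    chainBoundary gridSrc gridTgt z (i, j) = z ((i, j), true) + z ((i, j), false) +
      (if i = 0 then 0 else z ((i - 1, j), true)) +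
      (if j = 0 then 0 else z ((i, j - 1), false)) := by
  classical
  induction z using Finsupp.induction_linear with
  | zero => simp
  | add f g hf hg =>
    rw [map_add, Finsupp.add_apply, hf, hg]
    simp only [Finsupp.add_apply]
    split_ifs <;> ring
  | single e c =>
    obtain ⟨⟨p, q⟩, d⟩ := e
    rw [chainBoundary_single]
    cases d <;> simp only [Finsupp.add_apply, Finsupp.single_apply, gridSrc, gridTgt, Prod.mk.injEq,
      if_true, Bool.false_eq_true, if_false, and_true, and_false, add_zero, zero_add, ite_self,
      reduceCtorEq]
    · rcases j with _ | j <;> simp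
    · rcases i with _ | i <;> simp

/-- For a cycle, the vertex conditions going up a column show inductively that `φ` also changes
correctly across vertical edges. Conversely, in the boundary of a cut at a grid point, every face
around that point occurs twice. -/
theorem chainBoundary_grid_eq_zero_iff (z : (ℕ × ℕ) × Bool →₀ ZMod 2) :
    chainBoundary gridSrc gridTgt z = 0 ↔
      ∃ φ : ℕ × ℕ → ZMod 2, ∀ e, z e = φ (gridLeft e) + φ (gridRight e) := by
  constructor
  · intro h
    have h' : ∀ i j, z ((i, j), true) + z ((i, j), false) +
      (if i = 0 then 0 else z ((i - 1, j), true)) +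
      (if j = 0 then 0 else z ((i, j - 1), false)) = 0 := fun i j => by
      rw [← chainBoundary_grid_apply, h, Finsupp.zero_apply]
    -- The parity of the edges of `z` crossed on the way straight down from the square to the
    -- unbounded face.
    let φ : ℕ × ℕ → ZMod 2 := fun p =>
      if p.1 = 0 then 0 else ∑ j ∈ range p.2, z ((p.1 - 1, j), true)
    refine ⟨φ, ?_⟩
    have hleft : ∀ i j, φ (gridLeft ((i, j), false)) = φ (i, j + 1) ∧
        φ (gridLeft ((i, j), true)) = φ (i + 1, j) := fun i j => by
      constructor
      · by_cases h : i = 0 <;> simp [gridLeft, φ, h]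
      · by_cases h : j = 0 <;> simp [gridLeft, φ, h]
    rintro ⟨⟨i, j⟩, _ | _⟩
    · rw [(hleft i j).1]
      simp only [gridRight, φ, if_false, Nat.add_one_ne_zero,
        Nat.add_sub_cancel]
      induction j with
      | zero =>
        have := h' i 0
        rw [CharTwo.add_eq_zero] at this
        simp only [if_true] at this
        simp only [zero_add, range_one, sum_singleton]
        split_ifs at this ⊢
        · generalize z ((i, 0), true) = a at this ⊢
          generalize z ((i, 0), false) = b at this ⊢
          revert a b; decide
        · generalize z ((i, 0), true) = a at this ⊢
          generalize z ((i, 0), false) = b at this ⊢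
          generalize z ((i - 1, 0), true) = c at this ⊢
          revert a b c; decide
      | succ j ih =>
        have := h' i (j + 1)
        rw [sum_range_succ, sum_range_succ _ (j + 1)]
        simp only [Nat.add_one_ne_zero, if_false, Nat.add_sub_cancel] at this
        split_ifs at this ih ⊢
        · rw [zero_add] at ih ⊢
          rw [← ih]
          generalize z ((i, j + 1), true) = a at this ⊢
          generalize z ((i, j + 1), false) = b at this ⊢
          generalize z ((i, j), false) = c at this ⊢
          clear ih
          revert a b c; decide
        · rw [add_add_add_comm, ← ih]
          generalize z ((i, j + 1), true) = a at this ⊢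
          generalize z ((i, j + 1), false) = b at this ⊢
          generalize z ((i, j), false) = c at this ⊢
          generalize z ((i - 1, j + 1), true) = d at this ⊢
          clear ih
          revert a b c d; decide
    · rw [(hleft i j).2]
      simp only [gridRight, φ, Nat.add_one_ne_zero, if_false,
        Nat.add_sub_cancel]
      rw [sum_range_succ, ← add_assoc, CharTwo.add_self_eq_zero, zero_add]
  · rintro ⟨φ, hφ⟩
    ext ⟨i, j⟩
    rw [chainBoundary_grid_apply, Finsupp.zero_apply]
    simp only [hφ, gridLeft, gridRight, if_true, Bool.false_eq_true, if_false]
    rcases i with _ | i <;> rcases j with _ | j <;>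
      simp only [Nat.add_one_ne_zero, if_true, if_false, Nat.add_sub_cancel, zero_add]
    all_goals grind

/-! ### Minors from connected sets of grid points -/

theorem StepIn.symm {P E : Type*} {s t : E → P} {A : Set P} {p q : P} (h : StepIn s t A p q) :
    StepIn s t A q p := by
  obtain ⟨hp, hq, e, he⟩ := h
  exact ⟨hq, hp, e, he.symm⟩

theorem StepIn.mono {P E : Type*} {s t : E → P} {A B : Set P} (hAB : A ⊆ B) {p q : P}
    (h : StepIn s t A p q) : StepIn s t B p q := by
  obtain ⟨hp, hq, he⟩ := h
  exact ⟨hAB hp, hAB hq, he⟩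

theorem walk_symm {P E : Type*} {s t : E → P} {A : Set P} {p q : P}
    (h : Relation.ReflTransGen (StepIn s t A) p q) :
    Relation.ReflTransGen (StepIn s t A) q p := by
  induction h with
  | refl => exact .refl
  | tail _ h ih => exact .head h.symm ih

theorem walk_mono {P E : Type*} {s t : E → P} {A B : Set P} (hAB : A ⊆ B) {p q : P}
    (h : Relation.ReflTransGen (StepIn s t A) p q) :
    Relation.ReflTransGen (StepIn s t B) p q :=
  Relation.ReflTransGen.mono (r := StepIn s t A) (fun _ _ => StepIn.mono hAB) _ _ h

namespace SimpleGraph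

/-- If the vertices and edges of `G` are represented by connected sets that meet only where a vertex
is incident with an edge, then `G` is a minor. -/
theorem hasDual_of_connected_sets {P E F : Type} (s t : E → P) (l r : E → F)
    (hdual : ∀ z : E →₀ ZMod 2,
      chainBoundary s t z = 0 ↔ ∃ φ : F → ZMod 2, ∀ e, z e = φ (l e) + φ (r e))
    (hsfin : ∀ A : Set P, A.Finite → {e | s e ∈ A ∧ t e ∈ A}.Finite)
    {V : Type*} [Fintype V] [DecidableEq V] (G : SimpleGraph V) [Fintype G.edgeSet]
    (C : V → Set P) (D : G.edgeSet → Set P) (a b : G.edgeSet → V)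
    (hab : ∀ e : G.edgeSet, (e : Sym2 V) = s(a e, b e))
    (hCfin : ∀ v, (C v).Finite) (hDfin : ∀ e, (D e).Finite) (hCne : ∀ v, (C v).Nonempty)
    (hC : ∀ v, WalkConnected s t (C v)) (hD : ∀ e, WalkConnected s t (D e))
    (hCC : ∀ u v, u ≠ v → Disjoint (C u) (C v)) (hDD : ∀ e f, e ≠ f → Disjoint (D e) (D f))
    (hCD : ∀ v, ∀ e : G.edgeSet, v ∉ (e : Sym2 V) → Disjoint (C v) (D e))
    (ha : ∀ e, (C (a e) ∩ D e).Nonempty) (hb : ∀ e, (C (b e) ∩ D e).Nonempty) : G.HasDual := by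
  have hne : ∀ e, a e ≠ b e := fun e h => by
    have := e.2
    rw [hab, h] at this
    exact G.loopless.irrefl _ this
  choose x hxC hxD using ha
  choose y hyC hyD using hb
  have hxb : ∀ e, x e ∉ C (b e) := fun e h => Set.disjoint_left.1 (hCC _ _ (hne e)) (hxC e) h
  -- The part of `D e` reachable from `x e` without entering `C (b e)`; it is added to the branch
  -- set of `a e`.
  let Q : G.edgeSet → Set P := fun e =>
    {q | Relation.ReflTransGen (StepIn s t (D e \ C (b e))) (x e) q}
  have hxQ : ∀ e, x e ∈ Q e := fun e => Relation.ReflTransGen.refl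
  have hQ : ∀ e, Q e ⊆ D e \ C (b e) := by
    intro e q hq
    induction (show Relation.ReflTransGen _ _ _ from hq) with
    | refl => exact ⟨hxD e, hxb e⟩
    | tail _ h _ => exact h.2.1
  have hQwalk : ∀ e, ∀ q ∈ Q e, Relation.ReflTransGen (StepIn s t (Q e)) (x e) q := by
    intro e q hq
    induction (show Relation.ReflTransGen _ _ _ from hq) with
    | refl => exact .refl
    | tail h1 h2 ih => exact (ih h1).tail ⟨h1, h1.tail h2, h2.2.2⟩
  -- A walk in `D e` from `x e` to `y e` leaves `Q e` only by stepping into `C (b e)`. This step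
  -- represents the edge `e` in the minor.
  have hexit : ∀ e, ∃ q ∈ Q e, ∃ z ∈ C (b e), ∃ d, (s d = q ∧ t d = z) ∨ (s d = z ∧ t d = q) := by
    intro e
    have key : ∀ z, Relation.ReflTransGen (StepIn s t (D e)) (x e) z → z ∈ Q e ∨
        ∃ q ∈ Q e, ∃ z ∈ C (b e), ∃ d, (s d = q ∧ t d = z) ∨ (s d = z ∧ t d = q) := by
      intro z hz
      induction hz with
      | refl => exact .inl (hxQ e)
      | @tail q z _ h ih =>
        rcases ih with ih | ih
        · by_cases hzb : z ∈ C (b e)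
          · exact .inr ⟨q, ih, z, hzb, h.2.2⟩
          · exact .inl (Relation.ReflTransGen.tail ih ⟨hQ e ih, ⟨h.2.1, hzb⟩, h.2.2⟩)
        · exact .inr ih
    exact (key _ (hD e _ (hxD e) _ (hyD e))).resolve_left fun h => (hQ e h).2 (hyC e)
  let U : V → Set P := fun v => C v ∪ ⋃ (e) (_ : a e = v), Q e
  have hCU : ∀ v, C v ⊆ U v := fun v => Set.subset_union_left
  have hQU : ∀ e, Q e ⊆ U (a e) := fun e q hq =>
    Or.inr (Set.mem_iUnion₂.2 ⟨e, rfl, hq⟩)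
  have hU : ∀ v p, p ∈ U v → p ∈ C v ∨ ∃ e, a e = v ∧ p ∈ Q e := by
    rintro v p (h | h)
    · exact .inl h
    · obtain ⟨e, he, hp⟩ := Set.mem_iUnion₂.1 h
      exact .inr ⟨e, he, hp⟩
  have hCQ : ∀ v e p, p ∈ C v → p ∈ Q e → v = a e := by
    intro v e p hv hp
    have h := hQ e hp
    by_contra hva
    refine Set.disjoint_left.1 (hCD v e ?_) hv h.1
    rw [hab, Sym2.mem_iff]
    rintro (rfl | rfl)
    · exact hva rfl
    · exact h.2 hv
  refine hasDual_of_minor s t l r hdual G U ?_ (fun v => (hCne v).mono (hCU v)) ?_ ?_ ?_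
  · intro v
    refine hsfin _ (((hCfin v).union (Set.finite_iUnion hDfin)).subset ?_)
    intro p hp
    rcases hU v p hp with h | ⟨e, -, h⟩
    · exact .inl h
    · exact .inr (Set.mem_iUnion.2 ⟨e, (hQ e h).1⟩)
  · intro u v p hu hv
    rcases hU u p hu with h1 | ⟨e, rfl, h1⟩ <;> rcases hU v p hv with h2 | ⟨f, rfl, h2⟩
    · by_contra h
      exact Set.disjoint_left.1 (hCC _ _ h) h1 h2
    · exact hCQ _ _ _ h1 h2
    · exact (hCQ _ _ _ h2 h1).symm
    · by_cases h : e = f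
      · rw [h]
      · exact (Set.disjoint_left.1 (hDD _ _ h) (hQ e h1).1 (hQ f h2).1).elim
  · intro v
    obtain ⟨o, ho⟩ := hCne v
    have key : ∀ p ∈ U v, Relation.ReflTransGen (StepIn s t (U v)) o p := by
      intro p hp
      rcases hU v p hp with h | ⟨e, rfl, h⟩
      · exact walk_mono (hCU v) (hC v _ ho _ h)
      · exact (walk_mono (hCU _) (hC _ _ ho _ (hxC e))).trans
          (walk_mono (hQU e) (hQwalk e p h))
    exact fun p hp q hq => (walk_symm (key p hp)).trans (key q hq)
  · intro e
    obtain ⟨q, hq, z, hz, d, ⟨rfl, rfl⟩ | ⟨rfl, rfl⟩⟩ := hexit e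
    · exact ⟨d, a e, b e, hab e, hQU e hq, hCU _ hz⟩
    · exact ⟨d, b e, a e, by rw [hab, Sym2.eq_swap], hCU _ hz, hQU e hq⟩

end SimpleGraph

/-! ### From plane sets to grid sets -/

/-- The grid points at distance less than `1` from `K`. -/
def cells (K : Set (ℝ × ℝ)) : Set (ℕ × ℕ) :=
  {p | ∃ x ∈ K, |x.1 - p.1| < 1 ∧ |x.2 - p.2| < 1}

theorem floor_mem_cells {K : Set (ℝ × ℝ)} {x : ℝ × ℝ} (hx : x ∈ K) (h1 : 0 ≤ x.1)
    (h2 : 0 ≤ x.2) : (⌊x.1⌋₊, ⌊x.2⌋₊) ∈ cells K := by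
  refine ⟨x, hx, ?_, ?_⟩ <;> rw [abs_lt]
  · have := Nat.floor_le h1
    have := Nat.lt_floor_add_one x.1
    constructor <;> simp only <;> linarith
  · have := Nat.floor_le h2
    have := Nat.lt_floor_add_one x.2
    constructor <;> simp only <;> linarith

theorem walkConnected_cells_singleton (x : ℝ × ℝ) :
    WalkConnected gridSrc gridTgt (cells {x}) := by
  rintro ⟨i, j⟩ ⟨y, h0, h1, h2⟩ ⟨i', j'⟩ ⟨y', h0', h1', h2'⟩
  rw [Set.mem_singleton_iff.1 h0] at h1 h2
  rw [Set.mem_singleton_iff.1 h0'] at h1' h2'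
  simp only at h1 h2 h1' h2'
  rw [abs_lt] at h1 h2 h1' h2'
  have hi : i = i' ∨ i' = i + 1 ∨ i = i' + 1 := by
    have a : (i : ℝ) < i' + 2 := by linarith
    have b : (i' : ℝ) < i + 2 := by linarith
    have a : i < i' + 2 := by exact_mod_cast a
    have b : i' < i + 2 := by exact_mod_cast b
    omega
  have hj : j = j' ∨ j' = j + 1 ∨ j = j' + 1 := by
    have a : (j : ℝ) < j' + 2 := by linarith
    have b : (j' : ℝ) < j + 2 := by linarith
    have a : j < j' + 2 := by exact_mod_cast a
    have b : j' < j + 2 := by exact_mod_cast b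
    omega
  have m1 : (i, j) ∈ cells {x} := ⟨x, rfl, abs_lt.2 h1, abs_lt.2 h2⟩
  have m2 : (i', j) ∈ cells {x} := ⟨x, rfl, abs_lt.2 h1', abs_lt.2 h2⟩
  have m3 : (i', j') ∈ cells {x} := ⟨x, rfl, abs_lt.2 h1', abs_lt.2 h2'⟩
  have s1 : Relation.ReflTransGen (StepIn gridSrc gridTgt (cells {x})) (i, j) (i', j) := by
    rcases hi with h | h | h
    · rw [h]
    · exact .single ⟨m1, m2, ((i, j), true), .inl ⟨rfl, by simp [gridTgt, h]⟩⟩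
    · exact .single ⟨m1, m2, ((i', j), true), .inr ⟨rfl, by simp [gridTgt, h]⟩⟩
  have s2 : Relation.ReflTransGen (StepIn gridSrc gridTgt (cells {x})) (i', j) (i', j') := by
    rcases hj with h | h | h
    · rw [h]
    · exact .single ⟨m2, m3, ((i', j), false), .inl ⟨rfl, by simp [gridTgt, h]⟩⟩
    · exact .single ⟨m2, m3, ((i', j'), false), .inr ⟨rfl, by simp [gridTgt, h]⟩⟩
  exact s1.trans s2

/-- Having cells joined by walks is symmetric and transitive on points, and nearby points are so
related because they share a cell, the coordinatewise floor. Nonnegative coordinates place this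
floor in the grid. -/
theorem walkConnected_cells {K : Set (ℝ × ℝ)} (hK : IsPreconnected K)
    (hpos : ∀ x ∈ K, 0 ≤ x.1 ∧ 0 ≤ x.2) : WalkConnected gridSrc gridTgt (cells K) := by
  have hsub : ∀ x ∈ K, cells {x} ⊆ cells K := by
    rintro x hx p ⟨_, rfl, h⟩
    exact ⟨_, hx, h⟩
  have hin : ∀ x ∈ K, ∀ p ∈ cells {x}, ∀ q ∈ cells {x},
      Relation.ReflTransGen (StepIn gridSrc gridTgt (cells K)) p q := fun x hx p hp q hq =>
    walk_mono (hsub x hx) (walkConnected_cells_singleton x p hp q hq)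
  have key : ∀ x ∈ K, ∀ y ∈ K, ∀ p ∈ cells {x}, ∀ q ∈ cells {y},
      Relation.ReflTransGen (StepIn gridSrc gridTgt (cells K)) p q := by
    intro x hx y hy
    refine hK.induction₂ (fun x y => ∀ p ∈ cells {x}, ∀ q ∈ cells {y},
      Relation.ReflTransGen (StepIn gridSrc gridTgt (cells K)) p q) ?_ ?_ ?_ hx hy
    · intro x hx
      obtain ⟨y, h0, h1, h2⟩ :=
        floor_mem_cells (Set.mem_singleton x) (hpos x hx).1 (hpos x hx).2
      rw [Set.mem_singleton_iff.1 h0] at h1 h2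
      have hev : ∀ᶠ y : ℝ × ℝ in 𝓝 x,
          |y.1 - (⌊x.1⌋₊ : ℕ)| < 1 ∧ |y.2 - (⌊x.2⌋₊ : ℕ)| < 1 :=
        (ContinuousAt.eventually_lt (f := fun y : ℝ × ℝ => |y.1 - (⌊x.1⌋₊ : ℕ)|) (by fun_prop)
          continuousAt_const h1).and
          (ContinuousAt.eventually_lt (f := fun y : ℝ × ℝ => |y.2 - (⌊x.2⌋₊ : ℕ)|) (by fun_prop)
            continuousAt_const h2)
      filter_upwards [nhdsWithin_le_nhds hev, self_mem_nhdsWithin] with y hy hyK p hp q hq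
      exact (hin x hx p hp (⌊x.1⌋₊, ⌊x.2⌋₊) ⟨x, rfl, h1, h2⟩).trans
        (hin y hyK _ ⟨y, rfl, hy⟩ q hq)
    · intro x y z hx hy hz hxy hyz p hp q hq
      have := floor_mem_cells (Set.mem_singleton y) (hpos y hy).1 (hpos y hy).2
      exact (hxy p hp _ this).trans (hyz _ this q hq)
    · intro x y hx hy h p hp q hq
      exact walk_symm (h q hq p hp)
  rintro p ⟨x, hx, hp⟩ q ⟨y, hy, hq⟩
  exact key x hx y hy p ⟨x, rfl, hp⟩ q ⟨y, rfl, hq⟩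

theorem finite_cells {K : Set (ℝ × ℝ)} {M : ℝ} (hK : ∀ x ∈ K, x.1 ≤ M ∧ x.2 ≤ M) :
    (cells K).Finite := by
  refine ((Set.finite_Iic (⌈M + 1⌉₊)).prod (Set.finite_Iic (⌈M + 1⌉₊))).subset ?_
  rintro ⟨i, j⟩ ⟨x, hx, h1, h2⟩
  simp only [abs_lt] at h1 h2
  have := hK x hx
  have := Nat.le_ceil (M + 1)
  constructor
  · have : (i : ℝ) ≤ ⌈M + 1⌉₊ := by linarith
    exact_mod_cast this
  · have : (j : ℝ) ≤ ⌈M + 1⌉₊ := by linarith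
    exact_mod_cast this

theorem disjoint_cells {K L : Set (ℝ × ℝ)} (h : ∀ x ∈ K, ∀ y ∈ L, 2 ≤ dist x y) :
    Disjoint (cells K) (cells L) := by
  rw [Set.disjoint_left]
  rintro p ⟨x, hx, hx1, hx2⟩ ⟨y, hy, hy1, hy2⟩
  have := h x hx y hy
  rw [Prod.dist_eq, Real.dist_eq, Real.dist_eq, le_max_iff] at this
  rw [abs_lt] at hx1 hx2 hy1 hy2
  simp only [le_abs] at this
  rcases this with (h | h) | (h | h) <;> linarith

theorem IsCompact.eventually_le_dist {X : Type*} [PseudoMetricSpace X] {K L : Set X}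
    (hK : IsCompact K) (hL : IsClosed L) (hKL : Disjoint K L) :
    ∀ᶠ d in 𝓝[>] (0 : ℝ), ∀ x ∈ K, ∀ y ∈ L, d < dist x y := by
  obtain ⟨r, hr, h⟩ := Metric.exists_pos_forall_lt_edist hK hL hKL
  filter_upwards [Ioo_mem_nhdsGT (NNReal.coe_pos.2 hr)] with d hd x hx y hy
  have := h x hx y hy
  rw [edist_dist, ENNReal.lt_ofReal_iff_toReal_lt ENNReal.coe_ne_top] at this
  exact hd.2.trans this

/-- Discs around the vertices (squares in the sup metric) and arcs cut off inside them are compact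
and connected. They meet where vertex and edge are incident, and any other two are at positive
distance, so a fine enough grid tells them apart. -/
theorem PlaneEmbedding.hasDual {V : Type*} [Fintype V] [DecidableEq V] {G : SimpleGraph V}
    [Fintype G.edgeSet] (Γ : PlaneEmbedding G) : G.HasDual := by
  have hends : ∀ e : G.edgeSet, ∃ a b : V, (e : Sym2 V) = s(a, b) ∧ Γ.arc e 0 = Γ.point a ∧
      Γ.arc e 1 = Γ.point b := by
    intro e
    have h := Γ.arc_ends e
    obtain ⟨u, v, huv⟩ : ∃ u v, (e : Sym2 V) = s(u, v) := by
      induction h : (e : Sym2 V) using Sym2.ind with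
      | _ u v => exact ⟨u, v, rfl⟩
    rw [huv, Sym2.map_mk, Sym2.eq_iff] at h
    rcases h with h | h
    · exact ⟨u, v, huv, h⟩
    · exact ⟨v, u, huv.trans Sym2.eq_swap, h⟩
  choose a b hab ha hb using hends
  have h01 : (0 : ℝ) ∈ Set.Icc (0 : ℝ) 1 := by simp
  have h11 : (1 : ℝ) ∈ Set.Icc (0 : ℝ) 1 := by simp
  -- the radius of the discs around the vertices
  obtain ⟨r, ⟨hrv, hre⟩, hr0⟩ : ∃ r : ℝ,
      ((∀ u v, u ≠ v → 2 * r < dist (Γ.point u) (Γ.point v)) ∧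
        ∀ v, ∀ e : G.edgeSet, v ∉ (e : Sym2 V) → ∀ t ∈ Set.Icc (0 : ℝ) 1,
          r < dist (Γ.point v) (Γ.arc e t)) ∧ 0 < r := by
    refine (Eventually.and (f := 𝓝[>] (0 : ℝ)) (Eventually.and ?_ ?_)
      self_mem_nhdsWithin).exists
    · simp only [eventually_all]
      intro u v huv
      have : 0 < dist (Γ.point u) (Γ.point v) :=
        dist_pos.2 fun h => huv (Γ.point_injective h)
      filter_upwards [Ioo_mem_nhdsGT (half_pos this)] with d hd
      linarith [hd.2]
    · simp only [eventually_all]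
      intro v e hve
      have hK := (isCompact_Icc.image_of_continuousOn (Γ.arc_continuousOn e))
      have hdisj : Disjoint {Γ.point v} (Γ.arc e '' Set.Icc 0 1) := by
        rw [Set.disjoint_singleton_left]
        rintro ⟨t, ht, h⟩
        rcases ht.1.eq_or_lt with rfl | h0
        · rw [ha] at h
          refine hve ?_
          rw [← Γ.point_injective h, hab]
          simp
        · rcases ht.2.eq_or_lt with rfl | h1
          · rw [hb] at h
            refine hve ?_
            rw [← Γ.point_injective h, hab]
            simp
          · exact Γ.arc_ne_point e t ⟨h0, h1⟩ v h
      filter_upwards [isCompact_singleton.eventually_le_dist hK.isClosed hdisj] with d hd t ht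
      exact hd _ rfl _ ⟨t, ht, rfl⟩
  -- the ends of the edges, cut off inside these discs
  obtain ⟨c, ⟨hc, hc0⟩, hc1⟩ : ∃ c : ℝ, ((∀ e, dist (Γ.arc e c) (Γ.arc e 0) < r ∧
      dist (Γ.arc e (1 - c)) (Γ.arc e 1) < r) ∧ 0 < c) ∧ c < 1 / 2 := by
    refine (Eventually.and (f := 𝓝[>] (0 : ℝ)) (Eventually.and ?_ self_mem_nhdsWithin) ?_).exists
    · simp only [eventually_all]
      intro e
      have hI : ∀ᶠ c in 𝓝[>] (0 : ℝ), c ∈ Set.Icc (0 : ℝ) 1 := by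
        filter_upwards [Ioo_mem_nhdsGT (zero_lt_one' ℝ)] with c hc using ⟨hc.1.le, hc.2.le⟩
      have t0 : Tendsto (fun c : ℝ => Γ.arc e c) (𝓝[>] 0) (𝓝 (Γ.arc e 0)) := by
        refine (Γ.arc_continuousOn e 0 h01).tendsto.comp ?_
        exact tendsto_nhdsWithin_iff.2 ⟨tendsto_nhdsWithin_of_tendsto_nhds tendsto_id, hI⟩
      have t1 : Tendsto (fun c : ℝ => Γ.arc e (1 - c)) (𝓝[>] 0) (𝓝 (Γ.arc e 1)) := by
        refine (Γ.arc_continuousOn e 1 h11).tendsto.comp ?_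
        refine tendsto_nhdsWithin_iff.2 ⟨tendsto_nhdsWithin_of_tendsto_nhds ?_, ?_⟩
        · have : Continuous fun c : ℝ => 1 - c := by fun_prop
          simpa using this.tendsto 0
        · filter_upwards [hI] with c hc
          exact ⟨by linarith [hc.2], by linarith [hc.1]⟩
      exact (t0.eventually (Metric.ball_mem_nhds _ hr0)).and
        (t1.eventually (Metric.ball_mem_nhds _ hr0))
    · filter_upwards [Ioo_mem_nhdsGT (half_pos (zero_lt_one' ℝ))] with c hc using hc.2
  let K : V → Set (ℝ × ℝ) := fun v => Metric.closedBall (Γ.point v) r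
  let A : G.edgeSet → Set (ℝ × ℝ) := fun e => Γ.arc e '' Set.Icc c (1 - c)
  have hIcc : Set.Icc c (1 - c) ⊆ Set.Icc 0 1 :=
    Set.Icc_subset_Icc hc0.le (by linarith)
  have hIoo : Set.Icc c (1 - c) ⊆ Set.Ioo 0 1 := fun t ht =>
    ⟨hc0.trans_le ht.1, ht.2.trans_lt (by linarith)⟩
  have hAcont : ∀ e, ContinuousOn (Γ.arc e) (Set.Icc c (1 - c)) := fun e =>
    (Γ.arc_continuousOn e).mono hIcc
  have hKc : ∀ v, IsCompact (K v) := fun v => isCompact_closedBall _ _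
  have hAc : ∀ e, IsCompact (A e) := fun e => isCompact_Icc.image_of_continuousOn (hAcont e)
  have hKK : ∀ u v, u ≠ v → Disjoint (K u) (K v) := fun u v huv =>
    Metric.closedBall_disjoint_closedBall (by linarith [hrv u v huv])
  have hKA : ∀ v, ∀ e : G.edgeSet, v ∉ (e : Sym2 V) → Disjoint (K v) (A e) := by
    intro v e hve
    rw [Set.disjoint_right]
    rintro _ ⟨t, ht, rfl⟩ h
    rw [Metric.mem_closedBall, dist_comm] at h
    exact (hre v e hve t (hIcc ht)).not_ge h
  have hAA : ∀ e f, e ≠ f → Disjoint (A e) (A f) := fun e f hef =>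
    (Γ.arc_disjoint e f hef).mono (Set.image_mono hIoo) (Set.image_mono hIoo)
  obtain ⟨d, ⟨⟨hd1, hd2⟩, hd3⟩, hd0⟩ : ∃ d : ℝ,
      (((∀ u v, u ≠ v → ∀ x ∈ K u, ∀ y ∈ K v, d < dist x y) ∧
        ∀ v, ∀ e : G.edgeSet, v ∉ (e : Sym2 V) → ∀ x ∈ K v, ∀ y ∈ A e, d < dist x y) ∧
          ∀ e f, e ≠ f → ∀ x ∈ A e, ∀ y ∈ A f, d < dist x y) ∧ 0 < d := by
    refine (Eventually.and (f := 𝓝[>] (0 : ℝ)) (Eventually.and (Eventually.and ?_ ?_) ?_)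
      self_mem_nhdsWithin).exists <;> simp only [eventually_all]
    · exact fun u v h => (hKc u).eventually_le_dist (hKc v).isClosed (hKK u v h)
    · exact fun v e h => (hKc v).eventually_le_dist (hAc e).isClosed (hKA v e h)
    · exact fun e f h => (hAc e).eventually_le_dist (hAc f).isClosed (hAA e f h)
  obtain ⟨M, hM⟩ : ∃ M : ℝ, (⋃ v, K v) ∪ (⋃ e, A e) ⊆ Metric.closedBall 0 M :=
    ((isCompact_iUnion hKc).union (isCompact_iUnion hAc)).isBounded.subset_closedBall 0
  -- The scaling turns distance `d` into 2, which suffices for disjoint cells; the shift by `M`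
  -- moves the drawing into the quadrant covered by the grid.
  let f : ℝ × ℝ → ℝ × ℝ := fun x => (2 / d * (x.1 + M), 2 / d * (x.2 + M))
  have hf : Continuous f := by fun_prop
  have hd2' : 0 < 2 / d := by positivity
  have hfd : ∀ x y, dist (f x) (f y) = 2 / d * dist x y := by
    intro x y
    simp only [f, Prod.dist_eq, Real.dist_eq]
    rw [mul_max_of_nonneg _ _ hd2'.le, ← abs_of_pos hd2', ← abs_mul, ← abs_mul, abs_of_pos hd2']
    congr 2 <;> ring
  have hsep : ∀ S T : Set (ℝ × ℝ), (∀ x ∈ S, ∀ y ∈ T, d < dist x y) →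
      Disjoint (cells (f '' S)) (cells (f '' T)) := by
    intro S T h
    apply disjoint_cells
    rintro _ ⟨x, hx, rfl⟩ _ ⟨y, hy, rfl⟩
    rw [hfd, div_mul_eq_mul_div, le_div_iff₀ hd0]
    linarith [h x hx y hy]
  have hbd : ∀ x ∈ (⋃ v, K v) ∪ (⋃ e, A e), (0 ≤ (f x).1 ∧ 0 ≤ (f x).2) ∧
      (f x).1 ≤ 2 / d * (2 * M) ∧ (f x).2 ≤ 2 / d * (2 * M) := by
    intro x hx
    have := hM hx
    rw [mem_closedBall_zero_iff, Prod.norm_def, max_le_iff, Real.norm_eq_abs, Real.norm_eq_abs,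
      abs_le, abs_le] at this
    refine ⟨⟨mul_nonneg hd2'.le ?_, mul_nonneg hd2'.le ?_⟩,
      mul_le_mul_of_nonneg_left ?_ hd2'.le, mul_le_mul_of_nonneg_left ?_ hd2'.le⟩ <;> linarith
  have hKsub : ∀ v, K v ⊆ (⋃ v, K v) ∪ (⋃ e, A e) := fun v x hx =>
    Or.inl (Set.mem_iUnion.2 ⟨v, hx⟩)
  have hAsub : ∀ e, A e ⊆ (⋃ v, K v) ∪ (⋃ e, A e) := fun e x hx =>
    Or.inr (Set.mem_iUnion.2 ⟨e, hx⟩)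
  have hfin : ∀ S ⊆ (⋃ v, K v) ∪ (⋃ e, A e), (cells (f '' S)).Finite := by
    intro S hS
    refine finite_cells (M := 2 / d * (2 * M)) ?_
    rintro _ ⟨x, hx, rfl⟩
    exact (hbd x (hS hx)).2
  have hconn : ∀ S ⊆ (⋃ v, K v) ∪ (⋃ e, A e), IsPreconnected S →
      WalkConnected gridSrc gridTgt (cells (f '' S)) := by
    intro S hS hSc
    refine walkConnected_cells (hSc.image f hf.continuousOn) ?_
    rintro _ ⟨x, hx, rfl⟩
    exact (hbd x (hS hx)).1
  have hmeet : ∀ x v e, x ∈ K v → x ∈ A e → (cells (f '' K v) ∩ cells (f '' A e)).Nonempty :=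
    fun x v e hv he => ⟨_, floor_mem_cells (Set.mem_image_of_mem f hv) (hbd x (hKsub v hv)).1.1
      (hbd x (hKsub v hv)).1.2, floor_mem_cells (Set.mem_image_of_mem f he)
      (hbd x (hKsub v hv)).1.1 (hbd x (hKsub v hv)).1.2⟩
  refine G.hasDual_of_connected_sets gridSrc gridTgt gridLeft gridRight
    chainBoundary_grid_eq_zero_iff ?_ (fun v => cells (f '' K v)) (fun e => cells (f '' A e))
    a b hab (fun v => hfin _ (hKsub v)) (fun e => hfin _ (hAsub e)) ?_ ?_ ?_
    (fun u v h => hsep _ _ (hd1 u v h)) (fun e f h => hsep _ _ (hd3 e f h))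
    (fun v e h => hsep _ _ (hd2 v e h)) (fun e => hmeet (Γ.arc e c) _ _ ?_ ?_)
    (fun e => hmeet (Γ.arc e (1 - c)) _ _ ?_ ?_)
  · intro S hS
    exact (hS.prod Set.finite_univ).subset fun e he => ⟨he.1, trivial⟩
  · intro v
    have hv : Γ.point v ∈ K v := Metric.mem_closedBall_self hr0.le
    exact ⟨_, floor_mem_cells (Set.mem_image_of_mem f hv) (hbd _ (hKsub v hv)).1.1
      (hbd _ (hKsub v hv)).1.2⟩
  · exact fun v => hconn _ (hKsub v) (convex_closedBall _ _).isPreconnected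
  · exact fun e => hconn _ (hAsub e) (isPreconnected_Icc.image _ (hAcont e))
  · exact Metric.mem_closedBall.2 (ha e ▸ (hc e).1.le)
  · exact ⟨c, ⟨le_rfl, by linarith⟩, rfl⟩
  · exact Metric.mem_closedBall.2 (hb e ▸ (hc e).2.le)
  · exact ⟨1 - c, ⟨by linarith, le_rfl⟩, rfl⟩

/-- A planar graph on `n ≥ 3` vertices without triangles has at most `2 n - 4` edges. -/
theorem IsPlanarGraph.card_edgeSet_add_four_le {V : Type*} [Fintype V] {G : SimpleGraph V}
    [Fintype G.edgeSet] (hG : IsPlanarGraph G) (h3 : G.CliqueFree 3)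
    (hV : 3 ≤ Fintype.card V) : Fintype.card G.edgeSet + 4 ≤ 2 * Fintype.card V := by
  classical
  obtain ⟨Γ⟩ := hG
  exact G.card_edgeSet_add_four_le_of_hasDual h3 hV Γ.hasDual

/-! ### Subgraphs and straight-line drawings -/

theorem IsPlanarGraph.of_injective_hom {V W : Type*} {G : SimpleGraph V} {H : SimpleGraph W}
    (hH : IsPlanarGraph H) (f : G →g H) (hf : Function.Injective f) : IsPlanarGraph G := by
  obtain ⟨Γ⟩ := hH
  have hinj := SimpleGraph.Hom.mapEdgeSet.injective f hf
  exact ⟨{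
    point := Γ.point ∘ f
    arc := fun e => Γ.arc (f.mapEdgeSet e)
    point_injective := Γ.point_injective.comp hf
    arc_continuousOn := fun e => Γ.arc_continuousOn _
    arc_injOn := fun e => Γ.arc_injOn _
    arc_ends := fun e => by
      rw [Γ.arc_ends, ← Sym2.map_map]
      rfl
    arc_ne_point := fun e t ht v => Γ.arc_ne_point _ t ht _
    arc_disjoint := fun e e' h => Γ.arc_disjoint _ _ (hinj.ne h) }⟩

/-- Straight-line drawings; `D` picks an orientation of every edge. -/
theorem IsPlanarGraph.of_segments {V : Type*} {G : SimpleGraph V} (p : V → ℝ × ℝ)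
    (hp : Function.Injective p) (D : V → V → Prop) (hD : ∀ u v, G.Adj u v → D u v ∨ D v u)
    (hv : ∀ u v w, D u v → p w ∉ openSegment ℝ (p u) (p v))
    (he : ∀ u v u' v', D u v → D u' v' → ∀ z ∈ openSegment ℝ (p u) (p v),
      z ∈ openSegment ℝ (p u') (p v') → u = u' ∧ v = v') : IsPlanarGraph G := by
  have hor : ∀ e : G.edgeSet, ∃ u v, (e : Sym2 V) = s(u, v) ∧ D u v ∧ G.Adj u v := by
    rintro ⟨e, he⟩
    induction e using Sym2.ind with
    | _ u v =>
      rcases hD u v he with h | h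
      · exact ⟨u, v, rfl, h, he⟩
      · exact ⟨v, u, Sym2.eq_swap, h, SimpleGraph.Adj.symm he⟩
  choose a b hab hDab hadj using hor
  have him : ∀ e t, t ∈ Set.Ioo (0 : ℝ) 1 →
      AffineMap.lineMap (p (a e)) (p (b e)) t ∈ openSegment ℝ (p (a e)) (p (b e)) := by
    intro e t ht
    rw [openSegment_eq_image_lineMap]
    exact ⟨t, ht, rfl⟩
  exact ⟨{
    point := p
    arc := fun e t => AffineMap.lineMap (p (a e)) (p (b e)) t
    point_injective := hp
    arc_continuousOn := fun e => AffineMap.lineMap_continuous.continuousOn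
    arc_injOn := fun e => (AffineMap.lineMap_injective ℝ (hp.ne (hadj e).ne)).injOn
    arc_ends := fun e => by
      rw [AffineMap.lineMap_apply_zero, AffineMap.lineMap_apply_one, hab, Sym2.map_mk]
    arc_ne_point := fun e t ht w h => hv _ _ w (hDab e) (h ▸ him e t ht)
    arc_disjoint := fun e f hef => by
      rw [Set.disjoint_left]
      rintro _ ⟨t, ht, rfl⟩ ⟨t', ht', h⟩
      have h' := him f t' ht'
      rw [show AffineMap.lineMap (p (a f)) (p (b f)) t' = AffineMap.lineMap (p (a e)) (p (b e)) t
        from h] at h'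
      have := he _ _ _ _ (hDab e) (hDab f) _ (him e t ht) h'
      exact hef (Subtype.ext (by rw [hab, hab, this.1, this.2])) }⟩

/-! ### Girth four and graphs given by lists -/

namespace SimpleGraph

theorem cliqueFree_three_of_bool_coloring {V : Type*} {G : SimpleGraph V} (c : V → Bool)
    (hc : ∀ u v, G.Adj u v → c u ≠ c v) : G.CliqueFree 3 := by
  classical
  intro s hs
  obtain ⟨x, y, z, hxy, hxz, hyz, -⟩ := is3Clique_iff.1 hs
  have h1 := hc _ _ hxy
  have h2 := hc _ _ hxz
  have h3 := hc _ _ hyz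
  cases hx : c x <;> cases hy : c y <;> cases hz : c z <;> simp_all

theorem four_le_egirth_iff {V : Type*} (G : SimpleGraph V) : 4 ≤ G.egirth ↔ G.CliqueFree 3 := by
  classical
  constructor
  · intro h s hs
    obtain ⟨v, w, hw, h3⟩ := is3Clique_iff_exists_cycle_length_three.1 ⟨s, hs⟩
    have := le_egirth.1 h v w hw
    rw [h3] at this
    exact absurd this (by decide)
  · intro h
    rw [le_egirth]
    intro v w hw
    have h3 := hw.three_le_length
    rcases h3.eq_or_lt with h3 | h3
    · obtain ⟨s, hs⟩ := is3Clique_iff_exists_cycle_length_three.2 ⟨v, w, hw, h3.symm⟩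
      exact (h s hs).elim
    · exact_mod_cast h3

/-- The graph with a given list of edges. -/
def ofList {n : ℕ} (E : List (Fin n × Fin n)) : SimpleGraph (Fin n) where
  Adj u v := u ≠ v ∧ ((u, v) ∈ E ∨ (v, u) ∈ E)
  symm := ⟨fun _ _ h => ⟨h.1.symm, h.2.symm⟩⟩
  loopless := ⟨fun _ h => h.1 rfl⟩

instance {n : ℕ} (E : List (Fin n × Fin n)) : DecidableRel (ofList E).Adj := fun u v =>
  inferInstanceAs (Decidable (u ≠ v ∧ ((u, v) ∈ E ∨ (v, u) ∈ E)))

end SimpleGraph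

/-! ### Drawings with integer coordinates -/

/-- Twice the signed area of the triangle `p q r`. -/
def orientation {R : Type*} [Ring R] (p q r : R × R) : R :=
  (q.1 - p.1) * (r.2 - p.2) - (q.2 - p.2) * (r.1 - p.1)

/-- The segment from `r` to `s` lies on one side of the line through `p` and `q`. -/
def OnOneSide (p q r s : ℤ × ℤ) : Prop :=
  (0 ≤ orientation p q r ∧ 0 ≤ orientation p q s ∧ 0 < orientation p q r + orientation p q s) ∨
    (orientation p q r ≤ 0 ∧ orientation p q s ≤ 0 ∧
      orientation p q r + orientation p q s < 0)

instance (p q r s : ℤ × ℤ) : Decidable (OnOneSide p q r s) := by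
  unfold OnOneSide
  infer_instance

/-- The point of the real plane with given integer coordinates. -/
def castPoint (p : ℤ × ℤ) : ℝ × ℝ := (p.1, p.2)

theorem castPoint_injective : Function.Injective castPoint := by
  rintro ⟨a, b⟩ ⟨c, d⟩ h
  simpa [castPoint] using h

theorem orientation_castPoint (p q r : ℤ × ℤ) :
    orientation (castPoint p) (castPoint q) (castPoint r) = (orientation p q r : ℤ) := by
  simp [orientation, castPoint]

theorem orientation_eq_zero_of_mem_openSegment {p q z : ℝ × ℝ} (hz : z ∈ openSegment ℝ p q) :
    orientation p q z = 0 := by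
  obtain ⟨a, b, ha, hb, hab, rfl⟩ := hz
  obtain rfl : a = 1 - b := by linarith
  simp only [orientation, Prod.fst_add, Prod.snd_add, Prod.smul_fst, Prod.smul_snd, smul_eq_mul]
  ring

/-- Orientation is affine in its last argument, so at an inner point of rs it is a positive
combination of two values of equal sign, not both zero. Such a point is off the line pq. -/
theorem OnOneSide.disjoint {p q r s : ℤ × ℤ} (h : OnOneSide p q r s) :
    Disjoint (openSegment ℝ (castPoint p) (castPoint q))
      (openSegment ℝ (castPoint r) (castPoint s)) := by
  rw [Set.disjoint_left]
  intro z hz hz'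
  have h0 := orientation_eq_zero_of_mem_openSegment hz
  obtain ⟨a, b, ha, hb, hab, rfl⟩ := hz'
  have h1 : a * orientation (castPoint p) (castPoint q) (castPoint r) +
      b * orientation (castPoint p) (castPoint q) (castPoint s) = 0 := by
    rw [← h0]
    obtain rfl : a = 1 - b := by linarith
    simp only [orientation, Prod.fst_add, Prod.snd_add, Prod.smul_fst, Prod.smul_snd, smul_eq_mul]
    ring
  rw [orientation_castPoint, orientation_castPoint] at h1
  unfold OnOneSide at h
  generalize orientation p q r = x at *
  generalize orientation p q s = y at *
  rcases h with ⟨hx, hy, hxy⟩ | ⟨hx, hy, hxy⟩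
  · have hx' : (0 : ℝ) ≤ x := by exact_mod_cast hx
    have hy' : (0 : ℝ) ≤ y := by exact_mod_cast hy
    have hxy' : (0 : ℝ) < x + y := by exact_mod_cast hxy
    have := mul_nonneg ha.le hx'
    have := mul_nonneg hb.le hy'
    have hax : (a : ℝ) * x = 0 := by linarith
    have hby : (b : ℝ) * y = 0 := by linarith
    rw [(mul_eq_zero.1 hax).resolve_left ha.ne', (mul_eq_zero.1 hby).resolve_left hb.ne'] at hxy'
    linarith
  · have hx' : (x : ℝ) ≤ 0 := by exact_mod_cast hx
    have hy' : (y : ℝ) ≤ 0 := by exact_mod_cast hy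
    have hxy' : (x : ℝ) + y < 0 := by exact_mod_cast hxy
    have := mul_nonpos_of_nonneg_of_nonpos ha.le hx'
    have := mul_nonpos_of_nonneg_of_nonpos hb.le hy'
    have hax : (a : ℝ) * x = 0 := by linarith
    have hby : (b : ℝ) * y = 0 := by linarith
    rw [(mul_eq_zero.1 hax).resolve_left ha.ne', (mul_eq_zero.1 hby).resolve_left hb.ne'] at hxy'
    linarith

/-- For explicit data all three hypotheses are decidable. -/
theorem IsPlanarGraph.ofList {n : ℕ} (E : List (Fin n × Fin n)) (P : Fin n → ℤ × ℤ)
    (hP : ∀ u v, P u = P v → u = v)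
    (hv : ∀ e ∈ E, ∀ w, e.1 ≠ e.2 ∧ (w = e.1 ∨ w = e.2 ∨ orientation (P e.1) (P e.2) (P w) ≠ 0))
    (hE : E.Pairwise fun e f => OnOneSide (P e.1) (P e.2) (P f.1) (P f.2) ∨
      OnOneSide (P f.1) (P f.2) (P e.1) (P e.2)) : IsPlanarGraph (SimpleGraph.ofList E) := by
  have hinj : Function.Injective (castPoint ∘ P) :=
    castPoint_injective.comp fun u v h => hP u v h
  refine IsPlanarGraph.of_segments (castPoint ∘ P) hinj (fun u v => (u, v) ∈ E)
    (fun u v h => h.2) ?_ ?_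
  · intro u v w he hw
    obtain ⟨hne, h | h | h⟩ := hv _ he w
    · rw [h] at hw
      exact hne (hinj (left_mem_openSegment_iff.1 hw))
    · rw [h] at hw
      exact hne (hinj (right_mem_openSegment_iff.1 hw))
    · have := orientation_eq_zero_of_mem_openSegment hw
      simp only [Function.comp, orientation_castPoint] at this
      exact h (by exact_mod_cast this)
  · intro u v u' v' he hf z hz hz'
    by_contra hne
    have : Std.Symm fun e f : Fin n × Fin n => OnOneSide (P e.1) (P e.2) (P f.1) (P f.2) ∨
        OnOneSide (P f.1) (P f.2) (P e.1) (P e.2) := ⟨fun _ _ h => h.symm⟩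
    have := hE.forall he hf fun h => hne (Prod.mk.inj h)
    rcases this with h | h
    · exact Set.disjoint_left.1 h.disjoint hz hz'
    · exact Set.disjoint_left.1 h.disjoint hz' hz

/-! ### Decompositions of small complete graphs -/

/-- Pulling back along an injection lets one decomposition serve all smaller complete graphs. The
pullbacks are spanning, so `0 < k` is what covers the vertices. -/
theorem IsUnionOfPlanarGirth.of_family {n k : ℕ} {V : Type*} (hk : 0 < k) (f : Fin n → V)
    (hf : Function.Injective f) (H : Fin k → SimpleGraph V) (hp : ∀ i, IsPlanarGraph (H i))
    (h3 : ∀ i, (H i).CliqueFree 3) (hcov : ∀ u v, u ≠ v → ∃ i, (H i).Adj u v) :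
    IsUnionOfPlanarGirth 4 (⊤ : SimpleGraph (Fin n)) k := by
  let S : Fin k → (⊤ : SimpleGraph (Fin n)).Subgraph := fun i =>
    { verts := Set.univ
      Adj := fun a b => (H i).Adj (f a) (f b)
      adj_sub := fun {a b} h => by
        rw [SimpleGraph.top_adj]
        rintro rfl
        exact h.ne rfl
      edge_vert := fun _ => trivial
      symm := ⟨fun a b h => h.symm⟩ }
  let g : ∀ i, (S i).coe →g H i := fun i => ⟨fun a => f a, fun h => h⟩
  have hg : ∀ i, Function.Injective (g i) := fun i a b h => Subtype.ext (hf h)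
  refine ⟨S, fun i => ⟨(hp i).of_injective_hom (g i) (hg i), ?_⟩, ?_⟩
  · rw [SimpleGraph.four_le_egirth_iff]
    intro s hs
    classical
    obtain ⟨x, y, z, hxy, hxz, hyz, -⟩ := SimpleGraph.is3Clique_iff.1 hs
    exact h3 i {f x, f y, f z} (SimpleGraph.is3Clique_triple_iff.2 ⟨hxy, hxz, hyz⟩)
  · rw [eq_top_iff]
    constructor
    · intro v _
      rw [SimpleGraph.Subgraph.verts_iSup]
      exact Set.mem_iUnion.2 ⟨⟨0, hk⟩, trivial⟩
    · intro a b hab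
      rw [SimpleGraph.Subgraph.iSup_adj]
      exact hcov _ _ (hf.ne hab)

theorem isUnionOfPlanarGirth_of_lists {n N k : ℕ} (hk : 0 < k) (hn : n ≤ N)
    (E : Fin k → List (Fin N × Fin N)) (hp : ∀ i, IsPlanarGraph (SimpleGraph.ofList (E i)))
    (h3 : ∀ i, ∀ e ∈ E i, ∀ w, ¬ ((SimpleGraph.ofList (E i)).Adj e.1 w ∧
      (SimpleGraph.ofList (E i)).Adj e.2 w))
    (hcov : ∀ u v : Fin N, u ≠ v → ∃ i, (SimpleGraph.ofList (E i)).Adj u v) :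
    IsUnionOfPlanarGirth 4 (⊤ : SimpleGraph (Fin n)) k := by
  refine .of_family hk (Fin.castLE hn) (Fin.castLE_injective hn) _ hp (fun i => ?_) hcov
  intro s hs
  obtain ⟨x, y, z, hxy, hxz, hyz, -⟩ := SimpleGraph.is3Clique_iff.1 hs
  rcases hxy.2 with h | h
  · exact h3 i _ h z ⟨hxz, hyz⟩
  · exact h3 i _ h z ⟨hyz, hxz⟩

theorem isUnionOfPlanarGirth_two {n : ℕ} (hn : n ≤ 2) :
    IsUnionOfPlanarGirth 4 (⊤ : SimpleGraph (Fin n)) 1 := by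
  refine isUnionOfPlanarGirth_of_lists one_pos hn (fun _ => [(0, 1)])
    (fun _ => .ofList _ ![(0, 0), (1, 0)] ?_ ?_ ?_) ?_ ?_ <;> decide

/-- A pentagon and its complement, which is again a pentagon. -/
theorem isUnionOfPlanarGirth_five {n : ℕ} (hn : n ≤ 5) :
    IsUnionOfPlanarGirth 4 (⊤ : SimpleGraph (Fin n)) 2 := by
  refine isUnionOfPlanarGirth_of_lists two_pos hn
    ![[(0, 1), (1, 2), (2, 3), (3, 4), (0, 4)], [(0, 2), (2, 4), (1, 4), (1, 3), (0, 3)]]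
    ?_ (by decide) (by decide)
  rw [Fin.forall_fin_two]
  constructor
  · refine .ofList _ ![(0, 0), (2, 0), (3, 1), (2, 2), (0, 2)] ?_ ?_ ?_ <;> decide
  · refine .ofList _ ![(0, 0), (2, 2), (2, 0), (0, 2), (3, 1)] ?_ ?_ ?_ <;> decide

-- The lists have 13, 11 and 12 edges and partition the 36 edges of K_9.
set_option maxRecDepth 100000 in
theorem isUnionOfPlanarGirth_nine {n : ℕ} (hn : n ≤ 9) :
    IsUnionOfPlanarGirth 4 (⊤ : SimpleGraph (Fin n)) 3 := by
  refine isUnionOfPlanarGirth_of_lists three_pos hn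
    ![[(0, 2), (0, 3), (0, 8), (1, 2), (1, 3), (1, 4), (2, 5), (2, 7), (3, 7), (4, 5), (4, 6),
        (5, 8), (6, 8)],
      [(0, 4), (0, 5), (0, 6), (1, 5), (1, 7), (1, 8), (2, 3), (3, 5), (3, 6), (4, 8), (6, 7)],
      [(0, 1), (0, 7), (1, 6), (2, 4), (2, 6), (2, 8), (3, 4), (3, 8), (4, 7), (5, 6), (5, 7),
        (7, 8)]] ?_ (by decide) (by decide)
  intro i
  fin_cases i
  · refine .ofList _ ![(5, 2), (1, 11), (4, 7), (0, 3), (7, 7), (5, 5), (7, 8), (3, 4), (11, 9)]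
      ?_ ?_ ?_ <;> decide
  · refine .ofList _ ![(7, 7), (0, 1), (11, 0), (10, 10), (7, 6), (8, 5), (4, 9), (1, 9), (3, 4)]
      ?_ ?_ ?_ <;> decide
  · refine .ofList _ ![(1, 4), (6, 0), (8, 4), (7, 10), (5, 6), (2, 6), (4, 2), (2, 10), (9, 11)]
      ?_ ?_ ?_ <;> decide

/-! ### Concentric drawings -/

/-- Vertices lie on the half-axes: `ax` chooses the axis (`true` for the horizontal one), `sg` the
side and `r` the distance from the origin. Two vertices are adjacent if they are at consecutive
distances, and either on the same half-axis or on different axes, the inner one lying on the axis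
determined by the parity of its distance. -/
def concentricStep {V : Type*} (r : V → ℕ) (ax sg : V → Bool) (u v : V) : Prop :=
  r v = r u + 1 ∧ ((ax u = ax v ∧ sg u = sg v) ∨ (ax u = (r u).bodd ∧ ax v = !(r u).bodd))

/-- The graph of all edges permitted in a concentric drawing. -/
def concentricGraph {V : Type*} (r : V → ℕ) (ax sg : V → Bool) : SimpleGraph V where
  Adj u v := concentricStep r ax sg u v ∨ concentricStep r ax sg v u
  symm := ⟨fun _ _ h => h.symm⟩
  loopless := ⟨fun _ h => by rcases h with h | h <;> exact absurd h.1 (by omega)⟩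

theorem concentricGraph_cliqueFree {V : Type*} (r : V → ℕ) (ax sg : V → Bool) :
    (concentricGraph r ax sg).CliqueFree 3 := by
  refine SimpleGraph.cliqueFree_three_of_bool_coloring (fun v => (r v).bodd) fun u v h => ?_
  rcases h with h | h <;> rw [h.1] <;> simp

/-- The point at distance `t` from the origin on a half-axis. -/
def axisPoint (ax sg : Bool) (t : ℝ) : ℝ × ℝ :=
  let s := if sg then t else -t
  if ax then (s, 0) else (0, s)

/-- A coordinate of a point of the plane. -/
def axisCoord (ax : Bool) (z : ℝ × ℝ) : ℝ := if ax then z.1 else z.2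

/-- In the ℓ¹ norm the segment runs between two consecutive radii, and it stays on one half-axis or
in one open quadrant. The norm and the signs of the coordinates record where it lies. -/
theorem mem_openSegment_axisPoint {a s a' s' : Bool} {ρ : ℝ} (hρ : 0 < ρ)
    (h : (a = a' ∧ s = s') ∨ a' = !a) {z : ℝ × ℝ}
    (hz : z ∈ openSegment ℝ (axisPoint a s ρ) (axisPoint a' s' (ρ + 1))) :
    (∃ t ∈ Set.Ioo (0 : ℝ) 1, |z.1| + |z.2| = ρ + t) ∧ (s = true ↔ 0 < axisCoord a z) ∧
      (s' = true ↔ 0 < axisCoord a' z) ∧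
      ((a = a' ∧ axisCoord (!a) z = 0 ∧ axisCoord a z ≠ 0) ∨
        (a' = !a ∧ axisCoord a z ≠ 0 ∧ axisCoord a' z ≠ 0)) := by
  obtain ⟨x, t, hx, ht, hxt, rfl⟩ := hz
  obtain rfl : x = 1 - t := by linarith
  have h1 : 0 < (1 - t) * ρ := mul_pos hx hρ
  have h2 : 0 < t * (ρ + 1) := mul_pos ht (by linarith)
  have h3 : (1 - t) * ρ + t * (ρ + 1) = ρ + t := by ring
  have ht1 : t < 1 := by linarith
  have h4 : 0 < ρ + t := by linarith
  rcases h with ⟨rfl, rfl⟩ | rfl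
  · refine ⟨⟨t, ⟨ht, ht1⟩, ?_⟩, ?_, ?_, Or.inl ⟨rfl, ?_, ?_⟩⟩ <;> cases a <;> cases s <;>
      simp only [axisPoint, axisCoord, Prod.fst_add, Prod.snd_add, Prod.smul_fst, Prod.smul_snd,
        smul_eq_mul, if_true, Bool.false_eq_true, if_false, mul_zero, add_zero, abs_zero, zero_add,
        mul_neg, h3, ← neg_add, abs_neg, abs_of_pos h4, Bool.not_true, Bool.not_false, ne_eq,
        false_iff, true_iff, not_lt] <;> linarith
  · refine ⟨⟨t, ⟨ht, ht1⟩, ?_⟩, ?_, ?_, Or.inr ⟨rfl, ?_, ?_⟩⟩ <;> cases a <;> cases s <;>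
      cases s' <;>
      simp only [axisPoint, axisCoord, Prod.fst_add, Prod.snd_add, Prod.smul_fst, Prod.smul_snd,
        smul_eq_mul, if_true, Bool.false_eq_true, if_false, mul_zero, add_zero, zero_add,
        mul_neg, abs_neg, abs_of_pos h1, abs_of_pos h2, Bool.not_true, Bool.not_false, ne_eq,
        false_iff, true_iff, not_lt] <;> linarith

theorem abs_add_abs_axisPoint (a s : Bool) {ρ : ℝ} (hρ : 0 ≤ ρ) :
    |(axisPoint a s ρ).1| + |(axisPoint a s ρ).2| = ρ := by
  cases a <;> cases s <;> simp [axisPoint, abs_of_nonneg hρ]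

theorem axisPoint_injective {a s a' s' : Bool} {ρ ρ' : ℝ} (hρ : 0 < ρ) (hρ' : 0 < ρ')
    (h : axisPoint a s ρ = axisPoint a' s' ρ') : ρ = ρ' ∧ a = a' ∧ s = s' := by
  have h1 : ρ = ρ' := by
    rw [← abs_add_abs_axisPoint a s hρ.le, h, abs_add_abs_axisPoint a' s' hρ'.le]
  subst h1
  refine ⟨rfl, ?_⟩
  cases a <;> cases a' <;> cases s <;> cases s' <;> simp [axisPoint] at h ⊢ <;> linarith

theorem eq_of_natCast_add_eq {m n : ℕ} {s t : ℝ} (hs : s ∈ Set.Ico (0 : ℝ) 1)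
    (ht : t ∈ Set.Ico (0 : ℝ) 1) (h : m + s = n + t) : m = n := by
  have h1 : (m : ℝ) < n + 1 := by linarith [hs.1, ht.2]
  have h2 : (n : ℝ) < m + 1 := by linarith [hs.2, ht.1]
  have h1 : m < n + 1 := by exact_mod_cast h1
  have h2 : n < m + 1 := by exact_mod_cast h2
  omega

/-- A point determines the edge through it: the integer part of its ℓ¹ norm is the radius of the
inner end, a vanishing coordinate tells edges along a half-axis from slanted ones, and the signs
give the half-axes. -/
theorem concentricGraph_isPlanar {V : Type*} (r : V → ℕ) (ax sg : V → Bool) (hr : ∀ v, 0 < r v)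
    (hinj : ∀ u v, r u = r v → ax u = ax v → sg u = sg v → u = v) :
    IsPlanarGraph (concentricGraph r ax sg) := by
  have hr' : ∀ v, (0 : ℝ) < r v := fun v => by exact_mod_cast hr v
  have key : ∀ {u v z}, concentricStep r ax sg u v →
      z ∈ openSegment ℝ (axisPoint (ax u) (sg u) (r u)) (axisPoint (ax v) (sg v) (r v)) → _ :=
    fun {u v z} h hz => mem_openSegment_axisPoint (a := ax u) (s := sg u) (a' := ax v)
      (s' := sg v) (z := z) (hr' u) (h.2.imp_right fun h => by rw [h.1, h.2])
      (by have := h.1; rwa [this, Nat.cast_add, Nat.cast_one] at hz)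
  refine IsPlanarGraph.of_segments (fun v => axisPoint (ax v) (sg v) (r v)) ?_
    (concentricStep r ax sg) (fun u v h => h) ?_ ?_
  · intro u v h
    obtain ⟨h1, h2, h3⟩ := axisPoint_injective (hr' u) (hr' v) h
    exact hinj u v (by exact_mod_cast h1) h2 h3
  · intro u v w h hz
    obtain ⟨⟨t, ht, h1⟩, -⟩ := key h hz
    rw [abs_add_abs_axisPoint _ _ (hr' w).le] at h1
    have h2 : r w = r u := eq_of_natCast_add_eq (s := 0) (by simp) ⟨ht.1.le, ht.2⟩
      (by rw [add_zero, h1])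
    rw [h2] at h1
    linarith [ht.1]
  · intro u v u' v' h h' z hz hz'
    obtain ⟨⟨t, ht, h1⟩, h2, h3, h4⟩ := key h hz
    obtain ⟨⟨t', ht', h1'⟩, h2', h3', h4'⟩ := key h' hz'
    have hru : r u = r u' := eq_of_natCast_add_eq ⟨ht.1.le, ht.2⟩ ⟨ht'.1.le, ht'.2⟩
      (h1.symm.trans h1')
    have hrv : r v = r v' := by rw [h.1, h'.1, hru]
    have hax : ax u = ax u' ∧ ax v = ax v' := by
      rcases h4 with ⟨e, c0, c1⟩ | ⟨e, c0, c1⟩ <;> rcases h4' with ⟨e', d0, d1⟩ | ⟨e', d0, d1⟩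
      · have : ax u = ax u' := by
          by_contra hne
          rw [Bool.eq_not_of_ne hne] at c1
          exact c1 d0
        exact ⟨this, e ▸ e' ▸ this⟩
      · exfalso
        rw [e'] at d1
        cases h5 : ax u <;> cases h6 : ax u' <;> rw [h5] at c0 c1 <;> rw [h6] at d0 d1 <;>
          first | exact d0 c0 | exact d1 c0
      · exfalso
        rw [e] at c1
        cases h5 : ax u <;> cases h6 : ax u' <;> rw [h5] at c0 c1 <;> rw [h6] at d0 d1 <;>
          first | exact c0 d0 | exact c1 d0
      -- For slanted edges the parity rule fixes the axis of the inner end; otherwise two edges in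
      -- one quadrant could cross.
      · have q : ax u = (r u).bodd := by
          rcases h.2 with g | g
          · rw [g.1] at e
            exact absurd e (Bool.self_ne_not _)
          · exact g.1
        have q' : ax u' = (r u').bodd := by
          rcases h'.2 with g | g
          · rw [g.1] at e'
            exact absurd e' (Bool.self_ne_not _)
          · exact g.1
        have : ax u = ax u' := by rw [q, q', hru]
        exact ⟨this, by rw [e, e', this]⟩
    refine ⟨hinj _ _ hru hax.1 ?_, hinj _ _ hrv hax.2 ?_⟩
    · rw [Bool.eq_iff_iff, h2, h2', hax.1]
    · rw [Bool.eq_iff_iff, h3, h3', hax.2]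

/-! ### The graph of disjoint paths between two adjacent poles -/

/-- The oriented edges: from the pole `inr true` to the vertices `inl (c, true)`, from there to
`inl (c, false)`, and on to the pole `inr false`; and the edge between the poles. -/
inductive PoleStep {m : ℕ} : (Fin m × Bool) ⊕ Bool → (Fin m × Bool) ⊕ Bool → Prop
  | start (c : Fin m) : PoleStep (.inr true) (.inl (c, true))
  | middle (c : Fin m) : PoleStep (.inl (c, true)) (.inl (c, false))
  | finish (c : Fin m) : PoleStep (.inl (c, false)) (.inr false)
  | direct : PoleStep (.inr true) (.inr false)

/-- A side class of the bipartite graph given by `PoleStep`. -/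
def poleColor {m : ℕ} : (Fin m × Bool) ⊕ Bool → Bool
  | .inl (_, b) => b
  | .inr b => !b

theorem PoleStep.color_ne {m : ℕ} {u v : (Fin m × Bool) ⊕ Bool} (h : PoleStep u v) :
    poleColor u ≠ poleColor v := by
  cases h <;> simp [poleColor]

/-- Disjoint paths with three edges between two adjacent poles. -/
def poleGraph (m : ℕ) : SimpleGraph ((Fin m × Bool) ⊕ Bool) where
  Adj u v := PoleStep u v ∨ PoleStep v u
  symm := ⟨fun _ _ h => h.symm⟩
  loopless := ⟨fun _ h => by rcases h with h | h <;> exact h.color_ne rfl⟩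

theorem poleGraph_cliqueFree (m : ℕ) : (poleGraph m).CliqueFree 3 :=
  SimpleGraph.cliqueFree_three_of_bool_coloring poleColor fun _ _ h =>
    h.elim (fun h => h.color_ne) fun h => h.color_ne.symm

/-- A drawing of `poleGraph`. -/
def polePoint {m : ℕ} : (Fin m × Bool) ⊕ Bool → ℝ × ℝ
  | .inl (c, true) => (0, c + 1)
  | .inl (c, false) => (1, c + 1)
  | .inr true => (-1, 0)
  | .inr false => (2, 0)

/-- The edge of `poleGraph` in whose drawing a point lies. -/
theorem PoleStep.of_mem {m : ℕ} {u v : (Fin m × Bool) ⊕ Bool} (h : PoleStep u v) {z : ℝ × ℝ}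
    (hz : z ∈ openSegment ℝ (polePoint u) (polePoint v)) :
    (∃ c : Fin m, u = .inr true ∧ v = .inl (c, true) ∧ -1 < z.1 ∧ z.1 < 0 ∧
        z.2 = (c + 1) * (z.1 + 1) ∧ 0 < z.2) ∨
      (∃ c : Fin m, u = .inl (c, true) ∧ v = .inl (c, false) ∧ 0 < z.1 ∧ z.1 < 1 ∧
        z.2 = c + 1 ∧ 0 < z.2) ∨
      (∃ c : Fin m, u = .inl (c, false) ∧ v = .inr false ∧ 1 < z.1 ∧ z.1 < 2 ∧
        z.2 = (c + 1) * (2 - z.1) ∧ 0 < z.2) ∨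
      (u = .inr true ∧ v = .inr false ∧ -1 < z.1 ∧ z.1 < 2 ∧ z.2 = 0) := by
  obtain ⟨x, t, hx, ht, hxt, rfl⟩ := hz
  obtain rfl : x = 1 - t := by linarith
  cases h with
  | start c =>
    have : 0 < t * ((c : ℝ) + 1) := by positivity
    refine .inl ⟨c, rfl, rfl, ?_⟩
    simp only [polePoint, Prod.fst_add, Prod.snd_add, Prod.smul_fst, Prod.smul_snd, smul_eq_mul]
    refine ⟨?_, ?_, ?_, ?_⟩ <;> linarith
  | middle c =>
    have : 0 ≤ (c : ℝ) := by positivity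
    refine .inr (.inl ⟨c, rfl, rfl, ?_⟩)
    simp only [polePoint, Prod.fst_add, Prod.snd_add, Prod.smul_fst, Prod.smul_snd, smul_eq_mul]
    refine ⟨?_, ?_, ?_, ?_⟩ <;> linarith
  | finish c =>
    have : 0 < (1 - t) * ((c : ℝ) + 1) := by positivity
    refine .inr (.inr (.inl ⟨c, rfl, rfl, ?_⟩))
    simp only [polePoint, Prod.fst_add, Prod.snd_add, Prod.smul_fst, Prod.smul_snd, smul_eq_mul]
    refine ⟨?_, ?_, ?_, ?_⟩ <;> linarith
  | direct =>
    refine .inr (.inr (.inr ⟨rfl, rfl, ?_⟩))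
    simp only [polePoint, Prod.fst_add, Prod.snd_add, Prod.smul_fst, Prod.smul_snd, smul_eq_mul]
    refine ⟨?_, ?_, ?_⟩ <;> linarith

/-- The three kinds of path edges occupy different vertical strips, and within a strip the height or
slope identifies the path. The edge between the poles runs below, at height zero. -/
theorem poleGraph_isPlanar (m : ℕ) : IsPlanarGraph (poleGraph m) := by
  have hpos : ∀ c : Fin m, (0 : ℝ) < c + 1 := fun c => by positivity
  have hc : ∀ (c c' : Fin m) {x : ℝ}, 0 < x → ((c : ℝ) + 1) * x = (c' + 1) * x → c = c' := by
    intro c c' x hx h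
    have h := mul_right_cancel₀ hx.ne' h
    have h : (c : ℝ) = c' := by linarith
    exact Fin.ext (by exact_mod_cast h)
  refine IsPlanarGraph.of_segments polePoint ?_ PoleStep (fun _ _ h => h) ?_ ?_
  · rintro (⟨c, _ | _⟩ | _ | _) (⟨c', _ | _⟩ | _ | _) h <;>
      simp [polePoint, Fin.val_inj] at h ⊢ <;> first | exact h | linarith
  · intro u v w h hz
    have h1 := h.of_mem hz
    rcases w with ⟨c, _ | _⟩ | _ | _ <;> simp only [polePoint] at h1 <;>
      rcases h1 with ⟨c', -, -, h1⟩ | ⟨c', -, -, h1⟩ | ⟨c', -, -, h1⟩ | ⟨-, -, h1⟩ <;>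
      linarith [h1.1, h1.2.1]
  · intro u v u' v' h h' z hz hz'
    rcases h.of_mem hz with ⟨c, rfl, rfl, h1⟩ | ⟨c, rfl, rfl, h1⟩ | ⟨c, rfl, rfl, h1⟩ |
      ⟨rfl, rfl, h1⟩ <;>
    rcases h'.of_mem hz' with ⟨d, rfl, rfl, h2⟩ | ⟨d, rfl, rfl, h2⟩ | ⟨d, rfl, rfl, h2⟩ |
      ⟨rfl, rfl, h2⟩
    · rw [hc c d (x := z.1 + 1) (by linarith [h1.1]) (h1.2.2.1.symm.trans h2.2.2.1)]
      exact ⟨rfl, rfl⟩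
    · linarith [h1.2.1, h2.1]
    · linarith [h1.2.1, h2.1]
    · linarith [h1.2.2.2, h2.2.2]
    · linarith [h1.1, h2.2.1]
    · rw [hc c d (x := 1) one_pos (by rw [mul_one, mul_one]; exact h1.2.2.1.symm.trans h2.2.2.1)]
      exact ⟨rfl, rfl⟩
    · linarith [h1.2.1, h2.1]
    · linarith [h1.2.2.2, h2.2.2]
    · linarith [h1.1, h2.2.1]
    · linarith [h1.1, h2.2.1]
    · rw [hc c d (x := 2 - z.1) (by linarith [h1.2.1]) (h1.2.2.1.symm.trans h2.2.2.1)]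
      exact ⟨rfl, rfl⟩
    · linarith [h1.2.2.2, h2.2.2]
    · linarith [h2.2.2.2, h1.2.2]
    · linarith [h2.2.2.2, h1.2.2]
    · linarith [h2.2.2.2, h1.2.2]
    · exact ⟨rfl, rfl⟩

/-! ### Zigzag paths and the general decomposition -/

/-- The position of `c` on the `i`-th zigzag Hamiltonian path `i, i + 1, i - 1, i + 2, i - 2, …` of
the complete graph on the integers modulo `2 k`. -/
def zigzagPos (k i c : ℕ) : ℕ :=
  let d := if i ≤ c then c - i else c + 2 * k - i
  if d = 0 then 0 else if d ≤ k then 2 * d - 1 else 4 * k - 2 * d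

theorem zigzagPos_injective {k i c c' : ℕ} (hi : i < k) (hc : c < 2 * k) (hc' : c' < 2 * k)
    (h : zigzagPos k i c = zigzagPos k i c') : c = c' := by
  unfold zigzagPos at h
  grind

/-- Neighbours on the `i`-th path have sum 2i or 2i + 1 modulo 2k, and every other pair has a
different sum; so `i` is half of c + c', reduced modulo k. -/
theorem exists_zigzagPos_consecutive {k c c' : ℕ} (hc : c < 2 * k) (hc' : c' < 2 * k)
    (hne : c ≠ c') : ∃ i < k, zigzagPos k i c' = zigzagPos k i c + 1 ∨
      zigzagPos k i c = zigzagPos k i c' + 1 := by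
  by_cases h : (c + c') / 2 < k
  · refine ⟨(c + c') / 2, h, ?_⟩
    unfold zigzagPos
    grind
  · refine ⟨(c + c') / 2 - k, by omega, ?_⟩
    unfold zigzagPos
    grind

/-- The involution of the indices that exchanges `0` and `1`. -/
def swapZeroOne (i : ℕ) : ℕ := if i = 0 then 1 else if i = 1 then 0 else i

theorem swapZeroOne_swapZeroOne (i : ℕ) : swapZeroOne (swapZeroOne i) = i := by
  unfold swapZeroOne
  grind

/-- The place strictly between `2 j` and `2 j + 1` on the `i`-th zigzag path, where `j` is the
partner of `i`. -/
def gapPos (k i : ℕ) : ℕ :=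
  (zigzagPos k i (2 * swapZeroOne i) + zigzagPos k i (2 * swapZeroOne i + 1)) / 2

/-- The residues 2j and 2j + 1 are two places apart on the path unless the offset of 2j from `i` is
0 or k. For j = i this offset is i, bad only for i = 0, whence the exchange of 0 and 1. Path 0 then
has offset 2, which is different from k because `3 ≤ k`. -/
theorem zigzagPos_gapPos {k i : ℕ} (hk : 3 ≤ k) (hi : i < k) (c : ℕ)
    (hc : c = 2 * swapZeroOne i ∨ c = 2 * swapZeroOne i + 1) :
    zigzagPos k i c = gapPos k i + 1 ∨ gapPos k i = zigzagPos k i c + 1 := by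
  unfold gapPos zigzagPos swapZeroOne at *
  grind

/-- The distance from the origin in the `i`-th concentric drawing. -/
def zigzagRadius (k i : ℕ) : (Fin (2 * k) × Bool) ⊕ Bool → ℕ
  | .inl (c, _) => zigzagPos k i c + 1
  | .inr _ => gapPos k i + 1

/-- The axis in the `i`-th concentric drawing. -/
def zigzagAxis (k i : ℕ) : (Fin (2 * k) × Bool) ⊕ Bool → Bool
  | .inl (c, _) => (zigzagPos k i c + 1).bodd
  | .inr _ => !(gapPos k i + 1).bodd

/-- The poles share their radius with the copies of at most one residue and use the axis that these
leave free. -/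
theorem zigzag_isPlanar {k i : ℕ} (hi : i < k) :
    IsPlanarGraph (concentricGraph (zigzagRadius k i) (zigzagAxis k i) poleColor) := by
  apply concentricGraph_isPlanar
  · rintro (⟨c, b⟩ | b) <;> simp [zigzagRadius]
  · rintro (⟨c, b⟩ | b) (⟨c', b'⟩ | b') h1 h2 h3
    · have := zigzagPos_injective hi c.2 c'.2 (Nat.add_right_cancel h1)
      rw [Fin.ext this, show b = b' from h3]
    · simp only [zigzagRadius] at h1
      simp only [zigzagAxis, h1] at h2
      exact absurd h2 (Bool.self_ne_not _)
    · simp only [zigzagRadius] at h1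
      simp only [zigzagAxis, h1] at h2
      exact absurd h2.symm (Bool.self_ne_not _)
    · rw [Bool.not_inj (show (!b) = !b' from h3)]

/-- Axes alternate along the path, so consecutive residues have all four edges between their copies:
a ring of slanted segments. -/
theorem zigzag_adj_inl {k i : ℕ} {c c' : Fin (2 * k)} (b b' : Bool)
    (h : zigzagPos k i c' = zigzagPos k i c + 1 ∨ zigzagPos k i c = zigzagPos k i c' + 1) :
    (concentricGraph (zigzagRadius k i) (zigzagAxis k i) poleColor).Adj
      (.inl (c, b)) (.inl (c', b')) := by
  rcases h with h | h
  · exact .inl ⟨by simp [zigzagRadius, h], .inr ⟨rfl, by simp [zigzagRadius, zigzagAxis, h]⟩⟩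
  · exact .inr ⟨by simp [zigzagRadius, h], .inr ⟨rfl, by simp [zigzagRadius, zigzagAxis, h]⟩⟩

/-- A pole lies on the half-axis of the copies with its own color, one radius away from them. -/
theorem zigzag_adj_inr {k i : ℕ} {c : Fin (2 * k)} (b : Bool)
    (h : zigzagPos k i c = gapPos k i + 1 ∨ gapPos k i = zigzagPos k i c + 1) :
    (concentricGraph (zigzagRadius k i) (zigzagAxis k i) poleColor).Adj
      (.inl (c, !b)) (.inr b) := by
  rcases h with h | h
  · exact .inr ⟨by simp [zigzagRadius, h], .inl ⟨by simp [zigzagAxis, h], rfl⟩⟩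
  · exact .inl ⟨by simp [zigzagRadius, h], .inl ⟨by simp [zigzagAxis, h], rfl⟩⟩

/-- The concentric graphs miss only edges between the two copies of a residue, from `inl (c, b)` to
`inr b`, and between the poles; `poleGraph` supplies all of these. -/
theorem isUnionOfPlanarGirth_zigzag {n k : ℕ} (hk : 3 ≤ k) (hn : n ≤ 4 * k + 2) :
    IsUnionOfPlanarGirth 4 (⊤ : SimpleGraph (Fin n)) (k + 1) := by
  have hcard : n ≤ Fintype.card ((Fin (2 * k) × Bool) ⊕ Bool) := by
    simp
    omega
  obtain ⟨f⟩ := Function.Embedding.nonempty_of_card_le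
    (α := Fin n) (β := (Fin (2 * k) × Bool) ⊕ Bool) (by rwa [Fintype.card_fin])
  let H : Fin (k + 1) → SimpleGraph ((Fin (2 * k) × Bool) ⊕ Bool) := fun i =>
    if (i : ℕ) < k then concentricGraph (zigzagRadius k i) (zigzagAxis k i) poleColor
    else poleGraph (2 * k)
  have hH : ∀ i (hi : i < k), H ⟨i, by omega⟩ =
      concentricGraph (zigzagRadius k i) (zigzagAxis k i) poleColor := fun i hi => if_pos hi
  have hlast : H (Fin.last k) = poleGraph (2 * k) := if_neg (by simp)
  have hLL : ∀ (c : Fin (2 * k)) b c' b', (Sum.inl (c, b) : (Fin (2 * k) × Bool) ⊕ Bool) ≠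
      .inl (c', b') → ∃ i, (H i).Adj (.inl (c, b)) (.inl (c', b')) := by
    intro c b c' b' hne
    by_cases hc : c = c'
    · subst hc
      refine ⟨Fin.last k, ?_⟩
      rw [hlast]
      cases b <;> cases b'
      · exact (hne rfl).elim
      · exact .inr (.middle c)
      · exact .inl (.middle c)
      · exact (hne rfl).elim
    · obtain ⟨i, hi, h⟩ := exists_zigzagPos_consecutive c.2 c'.2 fun h => hc (Fin.ext h)
      refine ⟨⟨i, by omega⟩, ?_⟩
      rw [hH i hi]
      exact zigzag_adj_inl b b' h
  have hLR : ∀ (c : Fin (2 * k)) b b', ∃ i, (H i).Adj (.inl (c, b)) (.inr b') := by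
    intro c b b'
    by_cases hb : b = b'
    · subst hb
      refine ⟨Fin.last k, ?_⟩
      rw [hlast]
      cases b
      · exact .inl (.finish c)
      · exact .inr (.start c)
    -- The path whose partner pair contains `c`.
    · have hi : swapZeroOne (c / 2) < k := by
        have := c.2
        unfold swapZeroOne
        grind
      refine ⟨⟨swapZeroOne (c / 2), by omega⟩, ?_⟩
      rw [hH _ hi, Bool.eq_not_of_ne hb]
      refine zigzag_adj_inr b' (zigzagPos_gapPos hk hi c ?_)
      rw [swapZeroOne_swapZeroOne]
      omega
  refine .of_family k.succ_pos f f.injective H (fun i => ?_) (fun i => ?_) ?_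
  · by_cases hi : (i : ℕ) < k
    · rw [hH i hi]
      exact zigzag_isPlanar hi
    · rw [show H i = poleGraph (2 * k) from if_neg hi]
      exact poleGraph_isPlanar _
  · by_cases hi : (i : ℕ) < k
    · rw [hH i hi]
      exact concentricGraph_cliqueFree _ _ _
    · rw [show H i = poleGraph (2 * k) from if_neg hi]
      exact poleGraph_cliqueFree _
  · rintro (⟨c, b⟩ | b) (⟨c', b'⟩ | b') hne
    · exact hLL c b c' b' hne
    · exact hLR c b b'
    · obtain ⟨i, h⟩ := hLR c' b' b
      exact ⟨i, h.symm⟩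
    · refine ⟨Fin.last k, ?_⟩
      rw [hlast]
      cases b <;> cases b'
      · exact (hne rfl).elim
      · exact .inr .direct
      · exact .inl .direct
      · exact (hne rfl).elim

/-! ### Lower bounds -/

theorem two_mul_card_edgeSet_top (n : ℕ) :
    2 * Fintype.card (⊤ : SimpleGraph (Fin n)).edgeSet = n * (n - 1) := by
  have h := SimpleGraph.card_edgeFinset_top_eq_card_choose_two (V := Fin n)
  rw [SimpleGraph.edgeFinset_card, Fintype.card_fin, Nat.choose_two_right] at h
  have h2 : 2 ∣ n * (n - 1) := (Nat.even_mul_pred_self n).two_dvd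
  rw [← Nat.mul_div_cancel' h2, ← h]

/-- Each subgraph has at most 2n - 4 edges, and together they cover the n(n-1)/2 edges of K_n. -/
theorem IsUnionOfPlanarGirth.add_two_le {n k : ℕ} (hn : 3 ≤ n)
    (h : IsUnionOfPlanarGirth 4 (⊤ : SimpleGraph (Fin n)) k) : n + 2 ≤ 4 * k := by
  classical
  obtain ⟨H, hH, htop⟩ := h
  have hcard : ∀ i, Nat.card (H i).edgeSet + 4 ≤ 2 * n := by
    intro i
    obtain ⟨hp, hg⟩ := hH i
    have h3 := (SimpleGraph.four_le_egirth_iff _).1 hg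
    have he : Nat.card (H i).edgeSet ≤ Fintype.card (H i).coe.edgeSet := by
      rw [← SimpleGraph.Subgraph.image_coe_edgeSet_coe, ← Nat.card_eq_fintype_card]
      exact Nat.card_image_le (Set.toFinite _)
    have hv : Fintype.card (H i).verts ≤ n := by
      simpa using Fintype.card_subtype_le (· ∈ (H i).verts)
    -- On at most two vertices there is at most one edge, within the bound as `3 ≤ n`.
    by_cases h : 3 ≤ Fintype.card (H i).verts
    · have := hp.card_edgeSet_add_four_le h3 h
      omega
    · have h1 : Fintype.card (H i).coe.edgeSet ≤ (Fintype.card (H i).verts).choose 2 := by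
        rw [← SimpleGraph.edgeFinset_card]
        exact SimpleGraph.card_edgeFinset_le_card_choose_two
      have h2 : (Fintype.card (H i).verts).choose 2 ≤ 1 := by
        have := Nat.choose_le_choose 2 (show Fintype.card (H i).verts ≤ 2 by omega)
        simpa using this
      omega
  have hsum : Fintype.card (⊤ : SimpleGraph (Fin n)).edgeSet ≤ ∑ i, Nat.card (H i).edgeSet := by
    rw [← Nat.card_eq_fintype_card, ← SimpleGraph.Subgraph.edgeSet_top, ← htop,
      SimpleGraph.Subgraph.edgeSet_iSup, ← Nat.card_sigma]
    exact Nat.card_le_card_of_surjective _ (Set.sigmaToiUnion_surjective fun i => (H i).edgeSet)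
  have h1 : Fintype.card (⊤ : SimpleGraph (Fin n)).edgeSet + 4 * k ≤ k * (2 * n) := by
    have : ∑ i, (Nat.card (H i).edgeSet + 4) ≤ ∑ _i : Fin k, 2 * n :=
      Finset.sum_le_sum fun i _ => hcard i
    simp only [Finset.sum_add_distrib, Finset.sum_const, Finset.card_univ, Fintype.card_fin,
      smul_eq_mul] at this
    omega
  have h2 := two_mul_card_edgeSet_top n
  obtain ⟨m, rfl⟩ := Nat.exists_eq_add_of_le' hn
  rw [show m + 3 - 1 = m + 2 by omega] at h2
  -- From n(n-1) ≤ 4k(n-2) and 4k ≤ n + 1 would follow n² - n ≤ n² - n - 2.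
  by_contra hlt
  have h3 : 4 * k ≤ m + 4 := by omega
  nlinarith

theorem IsUnionOfPlanarGirth.pos {n k : ℕ} (hn : 0 < n)
    (h : IsUnionOfPlanarGirth 4 (⊤ : SimpleGraph (Fin n)) k) : 0 < k := by
  obtain ⟨H, -, htop⟩ := h
  have : (⟨0, hn⟩ : Fin n) ∈ (⨆ i, H i).verts := by
    rw [htop]
    trivial
  rw [SimpleGraph.Subgraph.verts_iSup] at this
  obtain ⟨i, -⟩ := Set.mem_iUnion.1 this
  exact i.pos

/-- By pigeonhole three of the five edges at vertex 0 have one color. Either an edge among their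
other ends repeats it, or those ends form a triangle of the opposite color. -/
theorem exists_monochromatic_triangle (c : Fin 6 → Fin 6 → Bool) :
    ∃ x y z, x ≠ y ∧ x ≠ z ∧ y ≠ z ∧ c x y = c x z ∧ c x y = c y z := by
  have key : ∀ f : Fin 6 → Bool, ∃ x y z : Fin 6, x ≠ y ∧ x ≠ z ∧ y ≠ z ∧ 0 ≠ x ∧ 0 ≠ y ∧ 0 ≠ z ∧
      f x = f y ∧ f x = f z := by decide
  obtain ⟨x, y, z, hxy, hxz, hyz, hx, hy, hz, h1, h2⟩ := key (c 0)
  by_cases e1 : c x y = c 0 x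
  · exact ⟨0, x, y, hx, hy, hxy, h1, e1.symm⟩
  by_cases e2 : c x z = c 0 x
  · exact ⟨0, x, z, hx, hz, hxz, h2, e2.symm⟩
  by_cases e3 : c y z = c 0 x
  · exact ⟨0, y, z, hy, hz, hyz, h1 ▸ h2, h1 ▸ e3.symm⟩
  exact ⟨x, y, z, hxy, hxz, hyz,
    (Bool.eq_not_of_ne e1).trans (Bool.eq_not_of_ne e2).symm,
    (Bool.eq_not_of_ne e1).trans (Bool.eq_not_of_ne e3).symm⟩

theorem not_isUnionOfPlanarGirth_six :
    ¬ IsUnionOfPlanarGirth 4 (⊤ : SimpleGraph (Fin 6)) 2 := by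
  classical
  rintro ⟨H, hH, htop⟩
  obtain ⟨x, y, z, hxy, hxz, hyz, h1, h2⟩ := exists_monochromatic_triangle
    fun i j => decide ((H 0).Adj i j)
  have hcov : ∀ i j : Fin 6, i ≠ j → (H 0).Adj i j ∨ (H 1).Adj i j := by
    intro i j hij
    have : (⨆ i, H i).Adj i j := by
      rw [htop]
      exact hij
    rw [SimpleGraph.Subgraph.iSup_adj, Fin.exists_fin_two] at this
    exact this
  have tri : ∀ i, (H i).Adj x y → (H i).Adj x z → (H i).Adj y z → False := by
    intro i a b c
    refine (SimpleGraph.four_le_egirth_iff _).1 (hH i).2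
      {⟨x, a.fst_mem⟩, ⟨y, a.snd_mem⟩, ⟨z, b.snd_mem⟩} ?_
    rw [SimpleGraph.is3Clique_triple_iff]
    exact ⟨a, b, c⟩
  rw [decide_eq_decide] at h1 h2
  by_cases h : (H 0).Adj x y
  · exact tri 0 h (h1.1 h) (h2.1 h)
  · exact tri 1 ((hcov _ _ hxy).resolve_left h) ((hcov _ _ hxz).resolve_left (mt h1.2 h))
      ((hcov _ _ hyz).resolve_left (mt h2.2 h))

/-! ### The values of the thickness -/

theorem girthThickness_eq {V : Type*} {g : ℕ∞} {G : SimpleGraph V} {k : ℕ}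
    (h : IsUnionOfPlanarGirth g G k) (hle : ∀ m, IsUnionOfPlanarGirth g G m → k ≤ m) :
    girthThickness g G = k :=
  le_antisymm (iInf₂_le k h) (le_iInf₂ fun m hm => by exact_mod_cast hle m hm)

theorem theorem1 :
    (∀ n : ℕ, 1 ≤ n → n ≠ 6 → n ≠ 10 →
      girthThickness 4 (⊤ : SimpleGraph (Fin n)) = ((⌈((n : ℚ) + 2) / 4⌉₊ : ℕ) : ℕ∞)) ∧
    girthThickness 4 (⊤ : SimpleGraph (Fin 6)) = 3 := by
  constructor
  · intro n h1 h6 h10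
    have hceil : ⌈((n : ℚ) + 2) / 4⌉₊ = (n + 5) / 4 := by
      have h1 : ((n + 5) / 4 : ℕ) * 4 ≤ n + 5 := Nat.div_mul_le_self _ _
      have h2 : n + 2 ≤ (n + 5) / 4 * 4 := by omega
      have h1' : (((n + 5) / 4 : ℕ) : ℚ) * 4 ≤ n + 5 := by exact_mod_cast h1
      have h2' : (n : ℚ) + 2 ≤ ((n + 5) / 4 : ℕ) * 4 := by exact_mod_cast h2
      rw [Nat.ceil_eq_iff (by omega), Nat.cast_sub (by omega), Nat.cast_one]
      constructor <;> linarith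
    rw [hceil]
    apply girthThickness_eq
    · rcases Nat.lt_or_ge n 11 with h | h
      · rcases Nat.lt_or_ge n 3 with h3 | h3
        · rw [show (n + 5) / 4 = 1 by omega]
          exact isUnionOfPlanarGirth_two (by omega)
        · rcases Nat.lt_or_ge n 6 with h6' | h6'
          · rw [show (n + 5) / 4 = 2 by omega]
            exact isUnionOfPlanarGirth_five (by omega)
          · rw [show (n + 5) / 4 = 3 by omega]
            exact isUnionOfPlanarGirth_nine (by omega)
      -- Here `11 ≤ n` gives `3 ≤ k`, as the zigzag construction requires.
      · obtain ⟨k, hk⟩ : ∃ k, (n + 5) / 4 = k + 1 := ⟨(n + 5) / 4 - 1, by omega⟩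
        rw [hk]
        exact isUnionOfPlanarGirth_zigzag (by omega) (by omega)
    · intro m hm
      -- For n ≤ 2 the lower bound 1 comes only from the need to cover a vertex.
      have := hm.pos h1
      rcases Nat.lt_or_ge n 3 with h | h
      · omega
      · have := hm.add_two_le h
        omega
  · apply girthThickness_eq (isUnionOfPlanarGirth_nine (by omega))
    intro m hm
    have h1 := hm.add_two_le (by omega)
    have h2 : m ≠ 2 := by
      rintro rfl
      exact not_isUnionOfPlanarGirth_six hm
    omega
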